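/- **Theorem 4.1 (dynamic inner product estimation).** The model is a unit-cost real RAM that can flip fair coins: real cells with exact field operations and comparisons (no rounding), and integer cells, holding words of $O(\log S)$ bits when the space is $S$, used for counters and indirect addressing. Write $\Lambda_\delta=\max\{1,\log(1/\delta)\}$ and $\kappa=\max\{1,\varepsilon^{-2}D^2\}$, and let $\widetilde O(f)$ denote $O(f\cdot\mathrm{poly}(\log (2+f)))$ with absolute constants. There is a randomized data structure, given by three fixed programs Init, Update and Query, such that for all integers $n,d\ge 1$ and reals $D>0$, $\varepsilon\in(0,1)$, $\delta\in(0,1)$ the following holds, the time and space bounds being worst-case over the coin flips and over all permitted sequences of operations. It uses $\widetilde O(\kappa\, n d\,\Lambda_\delta)$ space. * **Init**$(x_1,\dots,x_n,D,\varepsilon,\delta)$, for $x_i\in\mathbb R^d$ with $\|x_i\|_2\le D$, preprocesses the points in time $\widetilde O(\kappa\, n d\,\Lambda_\delta)$. * **Update**$(i,z)$, for $i\in\{1,\dots,n\}$ and $z\in\mathbb R^d$ with $\|z\|_2\le D$, replaces $x_i$ by $z$ in time $\widetilde O(\kappa\, d\,\Lambda_\delta)$. * **Query**$(q)$, for $q\in\mathbb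 R^d$ with $\|q\|_2\le 1$, outputs numbers $\widetilde w_1,\dots,\widetilde w_n$ in time $\widetilde O(\kappa\,(n+d)\,\Lambda_\delta)$. Moreover the answers are correct against adaptive use. Suppose that the initial points are fixed, and that before each query finitely many updates are made, where these updates and the query are chosen (within the norm bounds) as an arbitrary function of all earlier answers. Then for every $t\ge 1$, with probability at least $1-\delta$ the answer to the $t$-th query $q$ satisfies $$\langle q,x_i\rangle-\varepsilon\le \widetilde w_i\le\langle q,x_i\rangle+\varepsilon\qquad\text{for all } i\in\{1,\dots,n\},$$ where $x_1,\dots,x_n$ are the points current at that moment. -/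

import Mathlib

/-! ### A randomized real RAM with unit-cost steps

The machine has two banks of memory cells: integer cells, holding natural numbers and used for
counters and addresses, and real cells, holding real numbers.  Programs are finite terms that do not
depend on the input.  The only operations on reals are the field operations and comparisons (there
is no rounding), and the only source of randomness is an instruction that flips a fair coin. -/

namespace RealRAM

/-- The persistent memory of the machine. -/
structure Memory where
  int : ℕ → ℕ
  real : ℕ → ℝ

/-- All cells are zero. -/
def Memory.blank : Memory := ⟨fun _ => 0, fun _ => 0⟩

/-- During an operation the machine has, next to its memory, read-only arrays holding the arguments
of the operation and a write-only array for its result. -/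
structure State where
  mem : Memory
  intIn : ℕ → ℕ
  realIn : ℕ → ℝ
  out : ℕ → ℝ

/-- Deterministic instructions.  Arguments are addresses of cells unless said otherwise;
`M` is the integer bank, `R` the real bank. -/
inductive Instr
  /-- `M[a] := c` -/
  | intConst (a c : ℕ)
  /-- `M[a] := M[b] + M[c]` -/
  | intAdd (a b c : ℕ)
  /-- `M[a] := max (M[b] - M[c]) 0` -/
  | intSub (a b c : ℕ)
  /-- `M[a] := M[b] * M[c]` -/
  | intMul (a b c : ℕ)
  /-- `M[a] := M[M[b]]` -/
  | intLoad (a b : ℕ)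
  /-- `M[M[a]] := M[b]` -/
  | intStore (a b : ℕ)
  /-- `R[a] := c` -/
  | realConst (a : ℕ) (c : ℚ)
  /-- `R[a] := R[b] + R[c]` -/
  | realAdd (a b c : ℕ)
  /-- `R[a] := R[b] - R[c]` -/
  | realSub (a b c : ℕ)
  /-- `R[a] := R[b] * R[c]` -/
  | realMul (a b c : ℕ)
  /-- `R[a] := R[b] / R[c]` (zero if `R[c] = 0`) -/
  | realDiv (a b c : ℕ)
  /-- `R[a] := M[b]` -/
  | realOfInt (a b : ℕ)
  /-- `R[a] := R[M[b]]` -/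
  | realLoad (a b : ℕ)
  /-- `R[M[a]] := R[b]` -/
  | realStore (a b : ℕ)
  /-- `M[a] := intIn[M[b]]` -/
  | readInt (a b : ℕ)
  /-- `R[a] := realIn[M[b]]` -/
  | readReal (a b : ℕ)
  /-- `out[M[a]] := R[b]` -/
  | write (a b : ℕ)

/-- Write the value `v` to the integer cell `a`. -/
def State.setInt (s : State) (a v : ℕ) : State :=
  { s with mem := { s.mem with int := Function.update s.mem.int a v } }

/-- Write the value `v` to the real cell `a`. -/
noncomputable def State.setReal (s : State) (a : ℕ) (v : ℝ) : State :=
  { s with mem := { s.mem with real := Function.update s.mem.real a v } }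

/-- Effect of a deterministic instruction. -/
noncomputable def Instr.exec (s : State) : Instr → State
  | .intConst a c => s.setInt a c
  | .intAdd a b c => s.setInt a (s.mem.int b + s.mem.int c)
  | .intSub a b c => s.setInt a (s.mem.int b - s.mem.int c)
  | .intMul a b c => s.setInt a (s.mem.int b * s.mem.int c)
  | .intLoad a b => s.setInt a (s.mem.int (s.mem.int b))
  | .intStore a b => s.setInt (s.mem.int a) (s.mem.int b)
  | .realConst a c => s.setReal a (c : ℝ)
  | .realAdd a b c => s.setReal a (s.mem.real b + s.mem.real c)
  | .realSub a b c => s.setReal a (s.mem.real b - s.mem.real c)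
  | .realMul a b c => s.setReal a (s.mem.real b * s.mem.real c)
  | .realDiv a b c => s.setReal a (s.mem.real b / s.mem.real c)
  | .realOfInt a b => s.setReal a (s.mem.int b : ℝ)
  | .realLoad a b => s.setReal a (s.mem.real (s.mem.int b))
  | .realStore a b => s.setReal (s.mem.int a) (s.mem.real b)
  | .readInt a b => s.setInt a (s.intIn (s.mem.int b))
  | .readReal a b => s.setReal a (s.realIn (s.mem.int b))
  | .write a b => { s with out := Function.update s.out (s.mem.int a) (s.mem.real b) }

/-- Tests: comparison of two integer cells or of two real cells. -/
inductive Test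
  | intLt (a b : ℕ)
  | intLe (a b : ℕ)
  | realLt (a b : ℕ)
  | realLe (a b : ℕ)

/-- Truth of a test. -/
def Test.holds (s : State) : Test → Prop
  | .intLt a b => s.mem.int a < s.mem.int b
  | .intLe a b => s.mem.int a ≤ s.mem.int b
  | .realLt a b => s.mem.real a < s.mem.real b
  | .realLe a b => s.mem.real a ≤ s.mem.real b

/-- Programs.  `flip a` sets the integer cell `a` to a fair random bit. -/
inductive Cmd
  | instr (i : Instr)
  | flip (a : ℕ)
  | seq (p q : Cmd)
  | ite (b : Test) (p q : Cmd)
  | loop (b : Test) (p : Cmd)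

/-- A configuration: the commands that remain to be executed, and the state. -/
structure Config where
  code : List Cmd
  st : State

/-- The machine has halted when no command is left. -/
def Config.Halted (c : Config) : Prop := c.code = []

open Classical in
/-- One step of the machine, as a probability distribution on the next configuration. -/
noncomputable def step : Config → PMF Config
  | ⟨[], s⟩ => PMF.pure ⟨[], s⟩
  | ⟨.instr i :: k, s⟩ => PMF.pure ⟨k, i.exec s⟩
  | ⟨.flip a :: k, s⟩ =>
      (PMF.uniformOfFintype Bool).map fun b => ⟨k, s.setInt a (if b = true then 1 else 0)⟩
  | ⟨.seq p q :: k, s⟩ => PMF.pure ⟨p :: q :: k, s⟩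
  | ⟨.ite b p q :: k, s⟩ => PMF.pure (if b.holds s then ⟨p :: k, s⟩ else ⟨q :: k, s⟩)
  | ⟨.loop b p :: k, s⟩ =>
      PMF.pure (if b.holds s then ⟨p :: .loop b p :: k, s⟩ else ⟨k, s⟩)

/-- The distribution of the configuration after `t` steps. -/
noncomputable def runFor : ℕ → Config → PMF Config
  | 0, c => PMF.pure c
  | t + 1, c => (step c).bind (runFor t)

/-- Worst-case running time at most `T`: the machine halts within `T` steps whatever the outcomes of
the coin flips. -/
def HaltsWithin (T : ℕ) (c : Config) : Prop :=
  ∀ c' ∈ (runFor T c).support, c'.Halted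

/-- The memory contents fit into `S` cells of each bank, and the integers in use are smaller
than `S`, so that integer cells are words of about `log S` bits. -/
def Memory.Fits (S : ℕ) (m : Memory) : Prop :=
  ∀ a, m.int a < S ∧ (S ≤ a → m.int a = 0 ∧ m.real a = 0)

/-- Worst-case space at most `S`: the memory fits into `S` cells at all times. -/
def UsesSpace (S : ℕ) (c : Config) : Prop :=
  ∀ t, ∀ c' ∈ (runFor t c).support, c'.st.mem.Fits S

/-- Start the program `p` on memory `m` with the given arguments. -/
def start (p : Cmd) (m : Memory) (intIn : ℕ → ℕ) (realIn : ℕ → ℝ) : Config :=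
  ⟨[p], ⟨m, intIn, realIn, fun _ => 0⟩⟩

end RealRAM

/-! ### Dynamic data structures for adaptive inner product estimation -/

namespace IPE

open RealRAM

/-- The points live in Euclidean space `ℝ^d`. -/
abbrev Pt (d : ℕ) : Type := EuclideanSpace ℝ (Fin d)

/-- A data structure: one program for each of the three procedures. -/
structure DataStructure where
  init : Cmd
  update : Cmd
  query : Cmd

/-- The coordinates of a vector as a zero-padded array. -/
noncomputable def vecIn {d : ℕ} (v : Pt d) : ℕ → ℝ :=
  fun a => if h : a < d then v ⟨a, h⟩ else 0

/-- Integer arguments of the initialization: `n, d`. -/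
def initIntIn (n d : ℕ) : ℕ → ℕ
  | 0 => n
  | 1 => d
  | _ => 0

/-- Real arguments of the initialization: `D, ε, δ`, followed by the coordinates of the points,
point after point (the `j`-th coordinate of the `i`-th point is at position `3 + (i * d + j)`). -/
noncomputable def initRealIn {n d : ℕ} (D ε δ : ℝ) (x : Fin n → Pt d) : ℕ → ℝ
  | 0 => D
  | 1 => ε
  | 2 => δ
  | a + 3 =>
      if h : a < n * d then
        x (finProdFinEquiv.symm ⟨a, h⟩).1 (finProdFinEquiv.symm ⟨a, h⟩).2
      else 0

/-- Call of the initialization, on blank memory. -/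
noncomputable def DataStructure.initCall (P : DataStructure) {n d : ℕ} (D ε δ : ℝ)
    (x : Fin n → Pt d) : Config :=
  start P.init Memory.blank (initIntIn n d) (initRealIn D ε δ x)

/-- Call of the replacement of the `i`-th point by `z`. -/
noncomputable def DataStructure.updateCall (P : DataStructure) {n d : ℕ} (m : Memory)
    (i : Fin n) (z : Pt d) : Config :=
  start P.update m (fun a => if a = 0 then (i : ℕ) else 0) (vecIn z)

/-- Call of a query with the point `q`. -/
noncomputable def DataStructure.queryCall (P : DataStructure) {d : ℕ} (m : Memory)
    (q : Pt d) : Config :=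
  start P.query m (fun _ => 0) (vecIn q)

/-- The memory contents between calls that can occur, for some outcomes of the coin flips, when the
data structure is initialized with `n` points of norm at most `D` and is then used with any
sequence of replacements by points of norm at most `D` and of queries of norm at most `1`. -/
inductive Reachable (P : DataStructure) (n d : ℕ) (D ε δ : ℝ) : Memory → Prop
  | init (x : Fin n → Pt d) (hx : ∀ i, ‖x i‖ ≤ D) (t : ℕ) (c : Config)
      (hc : c ∈ (runFor t (P.initCall D ε δ x)).support) (hh : c.Halted) :
      Reachable P n d D ε δ c.st.mem
  | update (m : Memory) (hm : Reachable P n d D ε δ m) (i : Fin n) (z : Pt d) (hz : ‖z‖ ≤ D)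
      (t : ℕ) (c : Config) (hc : c ∈ (runFor t (P.updateCall m i z)).support) (hh : c.Halted) :
      Reachable P n d D ε δ c.st.mem
  | query (m : Memory) (hm : Reachable P n d D ε δ m) (q : Pt d) (hq : ‖q‖ ≤ 1)
      (t : ℕ) (c : Config) (hc : c ∈ (runFor t (P.queryCall m q)).support) (hh : c.Halted) :
      Reachable P n d D ε δ c.st.mem

/-- Worst-case bounds: `Ti`, `Tu`, `Tq` on the running times of the three procedures, in every
situation that can occur, and `S` on the space used at any moment. -/
structure WorstCase (P : DataStructure) (n d : ℕ) (D ε δ : ℝ) (Ti Tu Tq S : ℕ) : Prop where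
  init_time : ∀ x : Fin n → Pt d, (∀ i, ‖x i‖ ≤ D) → HaltsWithin Ti (P.initCall D ε δ x)
  init_space : ∀ x : Fin n → Pt d, (∀ i, ‖x i‖ ≤ D) → UsesSpace S (P.initCall D ε δ x)
  update_time : ∀ m, Reachable P n d D ε δ m → ∀ (i : Fin n) (z : Pt d), ‖z‖ ≤ D →
    HaltsWithin Tu (P.updateCall m i z)
  update_space : ∀ m, Reachable P n d D ε δ m → ∀ (i : Fin n) (z : Pt d), ‖z‖ ≤ D →
    UsesSpace S (P.updateCall m i z)
  query_time : ∀ m, Reachable P n d D ε δ m → ∀ q : Pt d, ‖q‖ ≤ 1 →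
    HaltsWithin Tq (P.queryCall m q)
  query_space : ∀ m, Reachable P n d D ε δ m → ∀ q : Pt d, ‖q‖ ≤ 1 →
    UsesSpace S (P.queryCall m q)

/-- One round of use: finitely many point replacements, then a query. -/
structure Move (n d : ℕ) where
  updates : List (Fin n × Pt d)
  query : Pt d

/-- An adaptive user: the next round may depend on the answers to all earlier queries (latest
first).  The user need not be computable.  A user who tosses coins is a mixture of such users. -/
abbrev Adversary (n d : ℕ) : Type := List (Fin n → ℝ) → Move n d

/-- The user respects the norm bounds. -/
def Adversary.Valid {n d : ℕ} (A : Adversary n d) (D : ℝ) : Prop :=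
  ∀ h, (∀ u ∈ (A h).updates, ‖u.2‖ ≤ D) ∧ ‖(A h).query‖ ≤ 1

/-- A session after some rounds: the memory of the machine, the current points, and the answers
given so far (latest first). -/
structure Session (n d : ℕ) where
  mem : Memory
  pts : Fin n → Pt d
  answers : List (Fin n → ℝ)

/-- Memory after a list of replacements, performed in order, each allotted `Tu` steps. -/
noncomputable def DataStructure.runUpdates (P : DataStructure) (Tu : ℕ) {n d : ℕ} :
    List (Fin n × Pt d) → Memory → PMF Memory
  | [], m => PMF.pure m
  | u :: us, m =>
      (runFor Tu (P.updateCall m u.1 u.2)).bind fun c => P.runUpdates Tu us c.st.mem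

/-- The points after a list of replacements, performed in order. -/
def applyUpdates {n d : ℕ} (us : List (Fin n × Pt d)) (x : Fin n → Pt d) : Fin n → Pt d :=
  us.foldl (fun y u => Function.update y u.1 u.2) x

/-- One round of the session. -/
noncomputable def DataStructure.round (P : DataStructure) (Tu Tq : ℕ) {n d : ℕ}
    (A : Adversary n d) (s : Session n d) : PMF (Session n d) :=
  (P.runUpdates Tu (A s.answers).updates s.mem).bind fun m =>
    (runFor Tq (P.queryCall m (A s.answers).query)).map fun c =>
      { mem := c.st.mem
        pts := applyUpdates (A s.answers).updates s.pts
        answers := (fun i => c.st.out (i : ℕ)) :: s.answers }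

/-- The distribution of the session after `t` rounds (that is, after `t` queries), when the machine
is allotted `Ti`, `Tu`, `Tq` steps for the procedures. -/
noncomputable def DataStructure.play (P : DataStructure) (Ti Tu Tq : ℕ) {n d : ℕ} (D ε δ : ℝ)
    (x : Fin n → Pt d) (A : Adversary n d) : ℕ → PMF (Session n d)
  | 0 => (runFor Ti (P.initCall D ε δ x)).map fun c => ⟨c.st.mem, x, []⟩
  | t + 1 => (P.play Ti Tu Tq D ε δ x A t).bind (P.round Tu Tq A)

/-- The latest answer estimates the inner products of the latest query with all the current points
up to an additive `ε`. -/
def Session.LastCorrect {n d : ℕ} (A : Adversary n d) (ε : ℝ) (s : Session n d) : Prop :=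
  match s.answers with
  | [] => True
  | w :: past => ∀ i,
      inner ℝ (A past).query (s.pts i) - ε ≤ w i ∧ w i ≤ inner ℝ (A past).query (s.pts i) + ε

/-- The factor `ε⁻² D²`, read as at least `1`. -/
noncomputable def accFactor (D ε : ℝ) : ℝ := max 1 ((ε ^ 2)⁻¹ * D ^ 2)

/-- The factor `log (1 / δ)`, read as at least `1`. -/
noncomputable def confFactor (δ : ℝ) : ℝ := max 1 (Real.log (1 / δ))

/-- `C * f * (log f) ^ k`, a typical representative of the soft-O class of `f ≥ 1`, with the
logarithm shifted to keep it above `1`. -/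
noncomputable def softBound (C : ℝ) (k : ℕ) (f : ℝ) : ℝ := C * f * Real.log (2 + f) ^ k

end IPE

/-! The structure stores the points and nothing random. A query draws fresh samples: coordinate `j`
of `q` is chosen with probability about `q j ^ 2 / 2`, and one chosen coordinate serves all `n`
points, since `z j * q j` divided by its probability is an unbiased estimate of the inner product
with `z`. A sample costs time O(n + d), and O(κ log (n/δ)) samples are averaged. Adaptivity is then
harmless: given any past, the memory holds the current points, the parameters, zero accumulators and
irrelevant scratch, so the coins of the next query are independent of all the adversary has seen.

Sampling must be exact with fair coins. The probabilities are rounded up to integer weights over `N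
= 2 ^ b`, with `2 * d ≤ N ≤ 4 * d`. Half of `N` carries the squares and the other half absorbs the
ceilings (`pre_le`); leftover numbers select a sample with value zero.

The rescaled samples may be huge, so they are truncated at `M`, by zero. No bias estimate or median
is needed: `exp_clip_le` bounds the exponential of the truncated variable by a quadratic in the
untruncated one, whose mean is exact and whose second moment is at most `2 * D ^ 2`. Hence the
potential `pot`, a sum over the points and both signs of exponentials of deviations, is a
supermartingale (`sum_pot_le`). It starts at `2 * n`, and a wrong answer forces it above `2 * n / δ`
(`one_le_pot`), so a Markov argument bounds the failure probability by `δ`, for all points together.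

The machine is treated by a Hoare logic with expectations: `Tri` bounds time, space and the expected
value of a function of the final state at once. The potential is the loop annotation in
`queryCmd_spec`; `play_correct` then conditions on the past. -/

open scoped ENNReal

namespace RealRAM

/-! ### A program logic for worst-case time, space and expectations -/

/-- Expectation of a nonnegative function. -/
noncomputable def expect {α : Type*} (p : PMF α) (f : α → ℝ≥0∞) : ℝ≥0∞ := ∑' a, p a * f a

lemma expect_pure {α : Type*} (a : α) (f : α → ℝ≥0∞) : expect (PMF.pure a) f = f a := by
  classical
  unfold expect
  rw [tsum_eq_single a]
  · simp
  · intro b hb; simp [PMF.pure_apply, hb]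

lemma expect_bind {α β : Type*} (p : PMF α) (q : α → PMF β) (f : β → ℝ≥0∞) :
    expect (p.bind q) f = expect p fun a => expect (q a) f := by
  unfold expect
  simp_rw [PMF.bind_apply, ← ENNReal.tsum_mul_right, ← ENNReal.tsum_mul_left]
  rw [ENNReal.tsum_comm]
  simp_rw [mul_assoc]

lemma expect_mono {α : Type*} (p : PMF α) {f g : α → ℝ≥0∞} (h : ∀ a ∈ p.support, f a ≤ g a) :
    expect p f ≤ expect p g := by
  unfold expect
  refine ENNReal.tsum_le_tsum fun a => ?_
  by_cases ha : p a = 0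
  · simp [ha]
  · exact mul_le_mul_right (h a ((PMF.mem_support_iff _ _).2 ha)) _

/-- From the configuration `c`, whatever the coins, the memory stays within `S` cells, the final
state satisfies `R`, the machine halts within `T` steps, and the expectation of `f` on the final
state is at most `v`. -/
structure Safe (S T : ℕ) (R : State → Prop) (f : State → ℝ≥0∞) (c : Config) (v : ℝ≥0∞) :
    Prop where
  fits : ∀ t, ∀ c' ∈ (runFor t c).support, c'.st.mem.Fits S
  post : ∀ t, ∀ c' ∈ (runFor t c).support, c'.Halted → R c'.st
  halts : ∀ t, T ≤ t → ∀ c' ∈ (runFor t c).support, c'.Halted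
  val : ∀ t, T ≤ t → expect (runFor t c) (fun c' => f c'.st) ≤ v

variable {S T : ℕ} {R : State → Prop} {f : State → ℝ≥0∞}

/-- Weakening the time budget is possible because `halts` and `val` speak of all times from `T` on,
not of `T` alone. -/
lemma Safe.mono {c : Config} {v v' : ℝ≥0∞} {T' : ℕ} (h : Safe S T R f c v) (hT : T ≤ T')
    (hv : v ≤ v') : Safe S T' R f c v' :=
  ⟨h.fits, h.post, fun t ht => h.halts t (hT.trans ht),
    fun t ht => (h.val t (hT.trans ht)).trans hv⟩

lemma runFor_nil (t : ℕ) (s : State) : runFor t ⟨[], s⟩ = PMF.pure ⟨[], s⟩ := by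
  induction t with
  | zero => rfl
  | succ t ih => simp [runFor, step, ih]

lemma Safe.done {s : State} (hs : s.mem.Fits S) (hR : R s) :
    Safe S T R f ⟨[], s⟩ (f s) where
  fits t c' hc := by
    rw [runFor_nil, PMF.support_pure, Set.mem_singleton_iff] at hc
    subst hc; exact hs
  post t c' hc _ := by
    rw [runFor_nil, PMF.support_pure, Set.mem_singleton_iff] at hc
    subst hc; exact hR
  halts t _ c' hc := by
    rw [runFor_nil, PMF.support_pure, Set.mem_singleton_iff] at hc
    subst hc; rfl
  val t _ := by rw [runFor_nil, expect_pure]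

/-- `g` assigns a value to each successor, and the value of `c` is their average. As `c` has not
halted, the postcondition is vacuous at time zero and only the space bound must be checked there. -/
lemma Safe.of_step {c : Config} (hs : c.st.mem.Fits S) (hc : c.code ≠ []) {v : ℝ≥0∞}
    (g : Config → ℝ≥0∞) (h : ∀ c' ∈ (step c).support, Safe S T R f c' (g c'))
    (hv : expect (step c) g ≤ v) : Safe S (T + 1) R f c v where
  fits t c' h' := by
    cases t with
    | zero =>
      rw [runFor, PMF.support_pure, Set.mem_singleton_iff] at h'
      subst h'; exact hs
    | succ t =>
      rw [runFor, PMF.mem_support_bind_iff] at h'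
      obtain ⟨d, hd, hd'⟩ := h'
      exact (h d hd).fits t c' hd'
  post t c' h' hh := by
    cases t with
    | zero =>
      rw [runFor, PMF.support_pure, Set.mem_singleton_iff] at h'
      subst h'; exact absurd hh hc
    | succ t =>
      rw [runFor, PMF.mem_support_bind_iff] at h'
      obtain ⟨d, hd, hd'⟩ := h'
      exact (h d hd).post t c' hd' hh
  halts t ht c' h' := by
    obtain ⟨t, rfl⟩ : ∃ t', t = t' + 1 := ⟨t - 1, by omega⟩
    rw [runFor, PMF.mem_support_bind_iff] at h'
    obtain ⟨d, hd, hd'⟩ := h'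
    exact (h d hd).halts t (by omega) c' hd'
  val t ht := by
    obtain ⟨t, rfl⟩ : ∃ t', t = t' + 1 := ⟨t - 1, by omega⟩
    rw [runFor, expect_bind]
    exact (expect_mono _ fun d hd => (h d hd).val t (by omega)).trans hv

lemma Safe.of_step_pure {c c' : Config} (hs : c.st.mem.Fits S) (hc : c.code ≠ []) {v : ℝ≥0∞}
    (hstep : step c = PMF.pure c') (h : Safe S T R f c' v) : Safe S (T + 1) R f c v := by
  refine Safe.of_step hs hc (fun _ => v) ?_ ?_
  · intro d hd
    rw [hstep, PMF.support_pure, Set.mem_singleton_iff] at hd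
    subst hd; exact h
  · rw [hstep, expect_pure]

lemma Safe.of_flip {s : State} {a : ℕ} {k : List Cmd} (hs : s.mem.Fits S) {v₀ v₁ v : ℝ≥0∞}
    (h₀ : Safe S T R f ⟨k, s.setInt a 0⟩ v₀) (h₁ : Safe S T R f ⟨k, s.setInt a 1⟩ v₁)
    (hv : 2⁻¹ * (v₀ + v₁) ≤ v) : Safe S (T + 1) R f ⟨.flip a :: k, s⟩ v := by
  classical
  refine Safe.of_step hs (by simp)
    (fun c => if c = ⟨k, s.setInt a 0⟩ then v₀ else v₁) ?_ ?_
  · intro c hc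
    simp only [step, PMF.mem_support_map_iff] at hc
    obtain ⟨b, -, rfl⟩ := hc
    -- Cell `a` tells the two successors apart, so a value may be assigned to them by cases.
    have hne : (⟨k, s.setInt a 1⟩ : Config) ≠ ⟨k, s.setInt a 0⟩ := by
      intro h
      have := congrArg (fun c : Config => c.st.mem.int a) h
      simp [State.setInt] at this
    cases b with
    | true => simpa [hne] using h₁
    | false => simpa using h₀
  · refine le_trans (le_of_eq ?_) hv
    have hne : (⟨k, s.setInt a 1⟩ : Config) ≠ ⟨k, s.setInt a 0⟩ := by
      intro h
      have := congrArg (fun c : Config => c.st.mem.int a) h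
      simp [State.setInt] at this
    rw [step, ← PMF.bind_pure_comp, expect_bind]
    simp only [Function.comp, expect_pure]
    have hne' : s.setInt a 1 ≠ s.setInt a 0 := fun h => hne (by rw [h])
    simp [expect, hne', mul_add, add_comm]

/-! ### Weighted triples and their rules -/

/-- Weighted triple: `p`, started in the state `s`, ends within `T` steps in a state satisfying
`Q`, and the expectation of `g` on that state is at most `v`.  The statement is in continuation
passing style. -/
def Tri (S T : ℕ) (p : Cmd) (s : State) (v : ℝ≥0∞) (Q : State → Prop) (g : State → ℝ≥0∞) : Prop :=
  ∀ (R : State → Prop) (f : State → ℝ≥0∞) (k : List Cmd) (T' : ℕ),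
    (∀ s', s'.mem.Fits S → Q s' → Safe S T' R f ⟨k, s'⟩ (g s')) →
      Safe S (T + T') R f ⟨p :: k, s⟩ v

/-- Triple for which expectations play no role. -/
def Det (S T : ℕ) (p : Cmd) (s : State) (Q : State → Prop) : Prop :=
  ∀ v, Tri S T p s v Q fun _ => v

variable {p q : Cmd} {s : State} {Q Q' : State → Prop} {g g' : State → ℝ≥0∞} {v : ℝ≥0∞}
  {T₁ T₂ : ℕ}

lemma Tri.mono {v' : ℝ≥0∞} (h : Tri S T₁ p s v' Q' g') (hT : T₁ ≤ T) (hv : v' ≤ v)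
    (hQ : ∀ s', Q' s' → Q s') (hg : ∀ s', Q' s' → g s' ≤ g' s') : Tri S T p s v Q g := by
  intro R f k T' hk
  refine (h R f k T' ?_).mono (by omega) hv
  intro s' hs' hQs
  exact (hk s' hs' (hQ s' hQs)).mono le_rfl (hg s' hQs)

lemma Det.mono (h : Det S T₁ p s Q') (hT : T₁ ≤ T) (hQ : ∀ s', Q' s' → Q s') :
    Det S T p s Q :=
  fun v => (h v).mono hT le_rfl hQ fun _ _ => le_rfl

/-- A deterministic fact yields an expectation bound as soon as `v` bounds `g` on every state
allowed by `Q`. -/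
lemma Det.tri (h : Det S T p s Q) (hg : ∀ s', Q s' → g s' ≤ v) : Tri S T p s v Q g :=
  (h v).mono le_rfl le_rfl (fun _ h => h) hg

/-- This is where continuation passing pays: with `q :: k` as the continuation of `p`, composition
is just application of the two hypotheses. The extra step unfolds the `seq` command. -/
lemma Tri.seq (hs : s.mem.Fits S) (hp : Tri S T₁ p s v Q g)
    (hq : ∀ s', s'.mem.Fits S → Q s' → Tri S T₂ q s' (g s') Q' g')
    (hT : T₁ + T₂ + 1 ≤ T) : Tri S T (.seq p q) s v Q' g' := by
  intro R f k T' hk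
  have h := hp R f (q :: k) (T₂ + T') fun s' hs' hQs => hq s' hs' hQs R f k T' hk
  exact (Safe.of_step_pure (c := ⟨.seq p q :: k, s⟩) hs (by simp) rfl h).mono (by omega) le_rfl

lemma Det.seq (hs : s.mem.Fits S) (hp : Det S T₁ p s Q)
    (hq : ∀ s', s'.mem.Fits S → Q s' → Det S T₂ q s' Q')
    (hT : T₁ + T₂ + 1 ≤ T) : Det S T (.seq p q) s Q' :=
  fun v => (hp v).seq hs (fun s' h h' => hq s' h h' v) hT

lemma Tri.flip {a : ℕ} (hs : s.mem.Fits S) (ha : a < S) (h1 : 1 < S)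
    (h₀ : Q (s.setInt a 0)) (h₁ : Q (s.setInt a 1))
    (hv : 2⁻¹ * (g (s.setInt a 0) + g (s.setInt a 1)) ≤ v) : Tri S 1 (.flip a) s v Q g := by
  intro R f k T' hk
  have fit : ∀ x, x < S → (s.setInt a x).mem.Fits S := by
    intro x hx b
    simp only [State.setInt, Function.update_apply]
    refine ⟨?_, fun hb => ?_⟩
    · split_ifs
      · exact hx
      · exact (hs b).1
    · rw [if_neg (by omega)]; exact (hs b).2 hb
  exact (Safe.of_flip hs (hk _ (fit 0 (by omega)) h₀) (hk _ (fit 1 h1) h₁) hv).mono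
    (by omega) le_rfl

lemma Det.ite {b : Test} (hs : s.mem.Fits S) (hp : b.holds s → Det S T₁ p s Q)
    (hq : ¬ b.holds s → Det S T₁ q s Q) (hT : T₁ + 1 ≤ T) : Det S T (.ite b p q) s Q := by
  intro v R f k T' hk
  by_cases hb : b.holds s
  · exact (Safe.of_step_pure (c := ⟨.ite b p q :: k, s⟩) hs (by simp) (by simp [step, hb])
      (hp hb v R f k T' hk)).mono (by omega) le_rfl
  · exact (Safe.of_step_pure (c := ⟨.ite b p q :: k, s⟩) hs (by simp) (by simp [step, hb])
      (hq hb v R f k T' hk)).mono (by omega) le_rfl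

/-- A loop that is run through exactly `K` times. -/
lemma Tri.loop {b : Test} (K : ℕ) (τ : ℕ → ℕ) (I : ℕ → State → Prop) (w : ℕ → State → ℝ≥0∞)
    (hs : s.mem.Fits S) (h0 : I 0 s) (hw : w 0 s ≤ v)
    (hlt : ∀ k < K, ∀ s, I k s → b.holds s) (hK : ∀ s, I K s → ¬ b.holds s)
    (hbody : ∀ k < K, ∀ s, s.mem.Fits S → I k s → Tri S (τ k) p s (w k s) (I (k + 1)) (w (k + 1)))
    (hT : (∑ k ∈ Finset.range K, (τ k + 1)) + 1 ≤ T) : Tri S T (.loop b p) s v (I K) (w K) := by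
  intro R f k T' hk
  -- Induction on the number `j` of rounds still to come, since values propagate backwards from the
  -- end of the loop.
  suffices H : ∀ j ≤ K, ∀ s : State, s.mem.Fits S → I (K - j) s →
      Safe S ((∑ k ∈ Finset.Ico (K - j) K, (τ k + 1)) + 1 + T') R f ⟨.loop b p :: k, s⟩
        (w (K - j) s) by
    have := H K le_rfl s hs (by simpa using h0)
    simp only [Nat.sub_self, ← Finset.range_eq_Ico] at this
    exact this.mono (by omega) hw
  intro j
  induction j with
  | zero =>
    intro _ s hs hI
    have := hK s (by simpa using hI)
    refine (Safe.of_step_pure (c := ⟨.loop b p :: k, s⟩) hs (by simp) (by simp [step, this])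
      (hk s hs (by simpa using hI))).mono ?_ le_rfl
    omega
  | succ j ih =>
    intro hj s hs hI
    have hb := hlt (K - (j + 1)) (by omega) s hI
    have e : K - (j + 1) + 1 = K - j := by omega
    have h := hbody (K - (j + 1)) (by omega) s hs hI R f (.loop b p :: k) _ (by
      rw [e]
      exact fun s' hs' hI' => ih (by omega) s' hs' hI')
    refine (Safe.of_step_pure (c := ⟨.loop b p :: k, s⟩) hs (by simp) (by simp [step, hb])
      h).mono ?_ le_rfl
    rw [Finset.sum_eq_sum_Ico_succ_bot (show K - (j + 1) < K by omega), e]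
    omega

lemma Det.loop {b : Test} (K : ℕ) (τ : ℕ) (I : ℕ → State → Prop)
    (hs : s.mem.Fits S) (h0 : I 0 s)
    (hlt : ∀ k < K, ∀ s, I k s → b.holds s) (hK : ∀ s, I K s → ¬ b.holds s)
    (hbody : ∀ k < K, ∀ s, s.mem.Fits S → I k s → Det S τ p s (I (k + 1)))
    (hT : K * (τ + 1) + 1 ≤ T) : Det S T (.loop b p) s (I K) :=
  fun v => Tri.loop K (fun _ => τ) I (fun _ _ => v) hs h0 le_rfl hlt hK
    (fun k hk s hs hI => hbody k hk s hs hI v) (by simpa using hT)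

/-! ### Straight-line code -/

/-- The instruction keeps the memory within `S` cells. -/
def Instr.Ok (S : ℕ) (s : State) : Instr → Prop
  | .intConst a c => a < S ∧ c < S
  | .intAdd a b c => a < S ∧ s.mem.int b + s.mem.int c < S
  | .intSub a b c => a < S ∧ s.mem.int b - s.mem.int c < S
  | .intMul a b c => a < S ∧ s.mem.int b * s.mem.int c < S
  | .intLoad a _ => a < S
  | .intStore a _ => s.mem.int a < S
  | .realConst a _ | .realAdd a _ _ | .realSub a _ _ | .realMul a _ _ | .realDiv a _ _
  | .realOfInt a _ | .realLoad a _ | .readReal a _ => a < S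
  | .realStore a _ => s.mem.int a < S
  | .readInt a b => a < S ∧ s.intIn (s.mem.int b) < S
  | .write _ _ => True

lemma Memory.Fits.setInt {a x : ℕ} (hs : s.mem.Fits S) (ha : a < S) (hx : x < S) :
    (s.setInt a x).mem.Fits S := by
  intro b
  simp only [State.setInt, Function.update_apply]
  refine ⟨?_, fun hb => ?_⟩
  · split_ifs
    · exact hx
    · exact (hs b).1
  · rw [if_neg (by omega)]; exact (hs b).2 hb

lemma Memory.Fits.setReal {a : ℕ} {x : ℝ} (hs : s.mem.Fits S) (ha : a < S) :
    (s.setReal a x).mem.Fits S := by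
  intro b
  simp only [State.setReal, Function.update_apply]
  refine ⟨(hs b).1, fun hb => ?_⟩
  rw [if_neg (by omega)]; exact (hs b).2 hb

lemma Instr.Ok.fits {i : Instr} (hi : i.Ok S s) (hs : s.mem.Fits S) : (i.exec s).mem.Fits S := by
  cases i
  case intConst => exact hs.setInt hi.1 hi.2
  case intAdd => exact hs.setInt hi.1 hi.2
  case intSub => exact hs.setInt hi.1 hi.2
  case intMul => exact hs.setInt hi.1 hi.2
  case readInt => exact hs.setInt hi.1 hi.2
  case intLoad => exact hs.setInt hi (hs _).1
  case intStore => exact hs.setInt hi (hs _).1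
  case write => exact hs
  all_goals exact hs.setReal hi

/-- Straight-line code. -/
def block : List Instr → Cmd
  | [] => .instr (.intConst 0 0)
  | [i] => .instr i
  | i :: j :: l => .seq (.instr i) (block (j :: l))

/-- Weakest precondition of straight-line code, including memory bounds. -/
def blockWP (S : ℕ) (Q : State → Prop) : List Instr → State → Prop
  | [], s => Q s
  | i :: l, s => i.Ok S s ∧ blockWP S Q l (i.exec s)

lemma Det.instr {i : Instr} (hs : s.mem.Fits S) (hi : i.Ok S s) (hQ : Q (i.exec s)) :
    Det S 1 (.instr i) s Q := by
  intro v R f k T' hk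
  exact (Safe.of_step_pure (c := ⟨.instr i :: k, s⟩) hs (by simp) rfl
    (hk _ (hi.fits hs) hQ)).mono (by omega) le_rfl

/-- Each instruction is charged two steps, one for itself and one for the `seq` around it. The empty
list is excluded because `block []` still writes to a cell, which `blockWP` does not reflect. -/
lemma Det.of_block {l : List Instr} (hl : l ≠ []) (hs : s.mem.Fits S) (h : blockWP S Q l s)
    (hT : 2 * l.length ≤ T) : Det S T (block l) s Q := by
  induction l generalizing s T with
  | nil => exact absurd rfl hl
  | cons i l ih =>
    cases l with
    | nil => exact (Det.instr hs h.1 h.2).mono (by simp at hT; omega) fun _ h => h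
    | cons j l =>
      exact Det.seq (T₁ := 1) (T₂ := 2 * (j :: l).length) hs
        (Det.instr (Q := fun s' => s' = i.exec s) hs h.1 rfl)
        (fun s' hs' e => by subst e; exact ih (by simp) hs' h.2 le_rfl)
        (by simp only [List.length_cons] at hT ⊢; omega)

lemma Tri.of_block {l : List Instr} (hl : l ≠ []) (hs : s.mem.Fits S)
    (h : blockWP S (fun s' => Q s' ∧ g s' ≤ v) l s) (hT : 2 * l.length ≤ T) :
    Tri S T (block l) s v Q g :=
  (Det.of_block hl hs h hT v).mono le_rfl le_rfl (fun _ h => h.1) fun _ h => h.2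

/-- `for M[a] = 0, …, M[b] - 1 do p`, with register `1` used to hold the constant one. -/
def forLoop (a b : ℕ) (p : Cmd) : Cmd :=
  .seq (.instr (.intConst a 0))
    (.loop (.intLt a b) (.seq p (block [.intConst 1 1, .intAdd a a 1])))

/-- The loop itself writes only to the counter `a` and to register `1`, so the invariant and the
weight must ignore these two cells (`hI`, `hwI`). The overhead of 6 per round is the test, two `seq`
commands and three further steps, all for incrementing and control. -/
lemma Tri.forLoop {a b : ℕ} (N : ℕ) (τ : ℕ → ℕ) (I : ℕ → State → Prop) (w : ℕ → State → ℝ≥0∞)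
    (hs : s.mem.Fits S) (ha : a < S) (h1 : 1 < S) (ha1 : a ≠ 1) (hb1 : b ≠ 1) (hab : b ≠ a)
    (hb : s.mem.int b = N) (h0 : I 0 s) (hw : w 0 s ≤ v)
    (hI : ∀ k s c x, c = 1 ∨ c = a → I k s → I k (s.setInt c x))
    (hwI : ∀ k s c x, c = 1 ∨ c = a → w k (s.setInt c x) = w k s)
    (hbody : ∀ k < N, ∀ s, s.mem.Fits S → I k s → s.mem.int a = k → s.mem.int b = N →
      Tri S (τ k) p s (w k s)
        (fun s => I (k + 1) s ∧ s.mem.int a = k ∧ s.mem.int b = N) (w (k + 1)))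
    (hT : (∑ k ∈ Finset.range N, τ k) + 6 * N + 3 ≤ T) :
    Tri S T (forLoop a b p) s v (I N) (w N) := by
  have hN : N < S := hb ▸ (hs b).1
  let J : ℕ → State → Prop := fun k s => I k s ∧ s.mem.int a = k ∧ s.mem.int b = N
  have hloop : ∀ s', s'.mem.Fits S → J 0 s' → Tri S ((∑ k ∈ Finset.range N, τ k) + 6 * N + 1)
      (.loop (.intLt a b) (.seq p (block [.intConst 1 1, .intAdd a a 1]))) s' (w 0 s')
        (J N) (w N) := by
    intro s' hs' hJ
    refine Tri.loop N (fun k => τ k + 5) J w hs' hJ le_rfl ?_ ?_ ?_ ?_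
    · intro k hk s hJ
      simp only [Test.holds, hJ.2.1, hJ.2.2, hk]
    · intro s hJ
      simp [Test.holds, hJ.2.1, hJ.2.2]
    · intro k hk s hs hJ
      refine Tri.seq (T₂ := 4) hs (hbody k hk s hs hJ.1 hJ.2.1 hJ.2.2) ?_ (by omega)
      intro s₂ hs₂ h₂
      refine Det.tri (Det.of_block
        (Q := fun s' => J (k + 1) s' ∧ w (k + 1) s' = w (k + 1) s₂) (by simp) hs₂ ?_ (by simp)) ?_
        |>.mono le_rfl le_rfl (fun _ h => h.1) (g := w (k + 1)) (g' := w (k + 1))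
          (fun _ _ => le_rfl)
      · have e : (s₂.setInt 1 1).mem.int a = k := by simp [State.setInt, ha1, h₂.2.1]
        have e' : (s₂.setInt 1 1).mem.int 1 = 1 := by simp [State.setInt]
        simp only [blockWP, Instr.Ok, Instr.exec, e, e', J]
        refine ⟨⟨h1, h1⟩, ⟨ha, by omega⟩, ⟨hI _ _ _ _ (.inr rfl) (hI _ _ _ _ (.inl rfl) h₂.1),
          ?_, ?_⟩, ?_⟩
        · simp [State.setInt]
        · simp [State.setInt, hb1, hab, h₂.2.2]
        · rw [hwI _ _ _ _ (.inr rfl), hwI _ _ _ _ (.inl rfl)]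
      · exact fun s' h => h.2.le
    · rw [Finset.sum_add_distrib, Finset.sum_add_distrib]
      simp; omega
  refine (Tri.seq (T₁ := 1) hs (Det.tri (g := w 0) (Q := fun s' => J 0 s' ∧ w 0 s' = w 0 s)
    (v := v) (Det.instr hs ?_ ?_) ?_)
    (fun s' hs' h => hloop s' hs' h.1) (by omega)).mono (T := T) le_rfl le_rfl
      (fun s' h => h.1) (fun _ _ => le_rfl)
  · exact ⟨ha, by omega⟩
  · refine ⟨⟨hI _ _ _ _ (.inr rfl) h0, ?_, ?_⟩, hwI _ _ _ _ (.inr rfl)⟩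
    · simp [State.setInt, Instr.exec]
    · simp [State.setInt, Instr.exec, hab, hb]
  · intro s' h; rw [h.2]; exact hw

lemma Det.forLoop {a b : ℕ} (N : ℕ) (τ : ℕ → ℕ) (I : ℕ → State → Prop)
    (hs : s.mem.Fits S) (ha : a < S) (h1 : 1 < S) (ha1 : a ≠ 1) (hb1 : b ≠ 1) (hab : b ≠ a)
    (hb : s.mem.int b = N) (h0 : I 0 s)
    (hI : ∀ k s c x, c = 1 ∨ c = a → I k s → I k (s.setInt c x))
    (hbody : ∀ k < N, ∀ s, s.mem.Fits S → I k s → s.mem.int a = k → s.mem.int b = N →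
      Det S (τ k) p s (fun s => I (k + 1) s ∧ s.mem.int a = k ∧ s.mem.int b = N))
    (hT : (∑ k ∈ Finset.range N, τ k) + 6 * N + 3 ≤ T) :
    Det S T (forLoop a b p) s (I N) :=
  fun v => Tri.forLoop N τ I (fun _ _ => v) hs ha h1 ha1 hb1 hab hb h0 le_rfl hI
    (fun _ _ _ _ _ => rfl) (fun k hk s hs h h' h'' => hbody k hk s hs h h' h'' v) hT

/-- From triples back to runs of the machine. -/
lemma Tri.safe (h : Tri S T p s v Q g) : Safe S T Q g ⟨[p], s⟩ v :=
  h Q g [] 0 fun _ hs' hQ => Safe.done hs' hQ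

end RealRAM

namespace IPE

/-! ### Sampling a coordinate by its square, with integer weights -/

/-- Integer weight of the `j`-th coordinate. -/
noncomputable def wt (H : ℝ) (q : ℕ → ℝ) (j : ℕ) : ℕ := ⌈H * (q j * q j)⌉₊

/-- Total weight of the coordinates before the `j`-th. -/
noncomputable def pre (H : ℝ) (q : ℕ → ℝ) (j : ℕ) : ℕ := ∑ i ∈ Finset.range j, wt H q i

/-- The coordinate selected by the random number `u`, and the reciprocal of its probability
multiplied by the coordinate of `q`; only the first `j` coordinates are considered. -/
noncomputable def sel (N : ℕ) (H : ℝ) (q : ℕ → ℝ) (u : ℕ) : ℕ → ℕ × ℝ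
  | 0 => (0, 0)
  | j + 1 => if pre H q j ≤ u ∧ u < pre H q (j + 1) then (j, q j * N / wt H q j)
      else sel N H q u j

/-- Truncation to `[-M, M]`, by zero. -/
noncomputable def clip (M y : ℝ) : ℝ := if y ≤ M then if -M ≤ y then y else 0 else 0

lemma pre_succ (H : ℝ) (q : ℕ → ℝ) (j : ℕ) : pre H q (j + 1) = pre H q j + wt H q j :=
  Finset.sum_range_succ _ _

lemma pre_mono (H : ℝ) (q : ℕ → ℝ) : Monotone (pre H q) :=
  monotone_nat_of_le_succ fun j => by rw [pre_succ]; omega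

lemma sel_of_le {N : ℕ} {H : ℝ} {q : ℕ → ℝ} {u j : ℕ} (h : pre H q j ≤ u) :
    sel N H q u j = (0, 0) := by
  induction j with
  | zero => rfl
  | succ j ih =>
    rw [sel, if_neg (by omega), ih ((pre_mono H q j.le_succ).trans h)]

/-- Even the default selection is the coordinate `0`, a legal index when `0 < j`, so reading the
selected coordinate never leaves the array. -/
lemma sel_fst_lt {N : ℕ} {H : ℝ} {q : ℕ → ℝ} {u j : ℕ} (hj : 0 < j) :
    (sel N H q u j).1 < j := by
  induction j with
  | zero => omega
  | succ j ih =>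
    rw [sel]
    split_ifs
    · exact j.lt_succ_self
    · rcases j.eq_zero_or_pos with rfl | h
      · simp [sel]
      · exact (ih h).trans j.lt_succ_self

/-- The intervals from `pre H q j` to `pre H q (j + 1)` are disjoint and have `wt H q j` elements; a
number in none of them keeps the default. Terms of weight zero vanish, so the division by the weight
is harmless. -/
lemma sum_sel {N : ℕ} {H : ℝ} {q : ℕ → ℝ} (F : ℕ × ℝ → ℝ) (d : ℕ) (hd : pre H q d ≤ N) :
    ∑ u ∈ Finset.range N, F (sel N H q u d) =
      N * F (0, 0) +
        ∑ j ∈ Finset.range d, wt H q j * (F (j, q j * N / wt H q j) - F (0, 0)) := by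
  induction d with
  | zero => simp [sel]
  | succ j ih =>
    have hj := pre_succ H q j
    have key : ∀ u, F (sel N H q u (j + 1)) = F (sel N H q u j) +
        if u ∈ Finset.Ico (pre H q j) (pre H q (j + 1)) then
          (F (j, q j * N / wt H q j) - F (0, 0)) else 0 := by
      intro u
      simp only [sel, Finset.mem_Ico]
      split_ifs with h
      · rw [sel_of_le h.1]; ring
      · ring
    simp_rw [key]
    rw [Finset.sum_add_distrib, ih (by omega), Finset.sum_range_succ, ← Finset.sum_filter]
    have : (Finset.range N).filter (· ∈ Finset.Ico (pre H q j) (pre H q (j + 1))) =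
        Finset.Ico (pre H q j) (pre H q (j + 1)) := by
      ext u; simp only [Finset.mem_filter, Finset.mem_range, Finset.mem_Ico]; omega
    rw [this, Finset.sum_const, Nat.card_Ico, nsmul_eq_mul, hj, Nat.add_sub_cancel_left]
    ring

/-- The squares contribute at most `N / 2`, and each ceiling at most 1 more, in total `N / 2 + d`.
This is why the weights are scaled by `N / 2` and not by `N`. -/
lemma pre_le {N d : ℕ} {q : ℕ → ℝ} (hq : ∑ j ∈ Finset.range d, q j ^ 2 ≤ 1) (hN : 2 * d ≤ N) :
    pre (N / 2) q d ≤ N := by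
  have h : ∀ j ∈ Finset.range d, (wt (N / 2) q j : ℝ) ≤ N / 2 * q j ^ 2 + 1 := by
    intro j _
    have := (Nat.ceil_lt_add_one (a := (N : ℝ) / 2 * (q j * q j))
      (mul_nonneg (by positivity) (mul_self_nonneg _))).le
    rw [pow_two]; exact this
  have h2 : (pre (N / 2) q d : ℝ) ≤ N / 2 * 1 + d := by
    unfold pre
    push_cast
    refine (Finset.sum_le_sum h).trans ?_
    rw [Finset.sum_add_distrib, ← Finset.mul_sum]
    simp only [Finset.sum_const, Finset.card_range, nsmul_eq_mul, mul_one]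
    have := mul_le_mul_of_nonneg_left hq (show (0 : ℝ) ≤ N / 2 by positivity)
    linarith
  have h3 : (2 : ℝ) * d ≤ N := by exact_mod_cast hN
  have : (pre (N / 2) q d : ℝ) ≤ N := by linarith
  exact_mod_cast this

/-! ### Exponential moments of a truncated sample -/

/-- With `t = σ / M * y`: if `|t| ≤ 1` this is the Taylor bound for the exponential; otherwise the
left side is 1 and `t + 2 * t ^ 2` is positive. So the truncated variable obeys a bound in the
untruncated `y`, and the bias of truncation never has to be estimated. -/
lemma exp_clip_le {M σ : ℝ} (hM : 0 < M) (hσ : σ ^ 2 = 1) (y : ℝ) :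
    Real.exp (σ / M * clip M y) ≤ 1 + σ / M * y + 2 * (y / M) ^ 2 := by
  have h1 : |σ| = 1 := by
    rw [← abs_one, ← sq_eq_sq_iff_abs_eq_abs, hσ, one_pow]
  set t := σ / M * y with ht
  have ht2 : (y / M) ^ 2 = t ^ 2 := by
    rw [ht]; field_simp; linear_combination (-y ^ 2) * hσ
  have habs : |t| = |y| / M := by rw [ht, abs_mul, abs_div, h1, abs_of_pos hM]; ring
  rw [ht2]
  by_cases h : |y| ≤ M
  · have hc : clip M y = y := by
      rw [clip, if_pos (abs_le.1 h).2, if_pos (abs_le.1 h).1]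
    rw [hc, ← ht]
    have h3 : |t| ≤ 1 := by rw [habs, div_le_one hM]; exact h
    have h2 := (abs_le.1 (Real.abs_exp_sub_one_sub_id_le h3)).2
    nlinarith [sq_nonneg t]
  · have hc : clip M y = 0 := by
      unfold clip; split_ifs with h2 h3
      · exact absurd (abs_le.2 ⟨h3, h2⟩) h
      · rfl
      · rfl
    rw [hc, mul_zero, Real.exp_zero]
    have h3 : 1 < |t| := by rw [habs, one_lt_div hM]; exact not_le.1 h
    have h4 := sq_abs t
    have h5 := neg_abs_le t
    nlinarith

/-- The contribution of a sample to the estimate of the inner product with `z`. -/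
noncomputable def contrib (N : ℕ) (M : ℝ) (q z : ℕ → ℝ) (d u : ℕ) : ℝ :=
  clip M (z (sel N (N / 2) q u d).1 * (sel N (N / 2) q u d).2)

/-- Summing `exp_clip_le` over the selections, the linear terms give the inner product exactly,
since the factor `N / wt` undoes the probability. As `wt` is at least `N / 2 * q j ^ 2`, the
quadratic term of coordinate `j` is at most `4 * z j ^ 2 / M ^ 2`. Then `1 + x ≤ exp x`. -/
lemma sum_exp_contrib_le {N d : ℕ} {M D σ : ℝ} {q z : ℕ → ℝ} (hM : 0 < M) (hσ : σ ^ 2 = 1)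
    (hN : 2 * d ≤ N) (hq : ∑ j ∈ Finset.range d, q j ^ 2 ≤ 1)
    (hz : ∑ j ∈ Finset.range d, z j ^ 2 ≤ D ^ 2) :
    ∑ u ∈ Finset.range N, Real.exp (σ / M * contrib N M q z d u) ≤
      N * Real.exp (σ / M * ∑ j ∈ Finset.range d, q j * z j + 4 * D ^ 2 / M ^ 2) := by
  unfold contrib
  rw [sum_sel (fun p => Real.exp (σ / M * clip M (z p.1 * p.2))) d (pre_le hq hN)]
  have h0 : clip M 0 = 0 := by simp [clip]
  simp only [mul_zero, h0, Real.exp_zero, mul_one]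
  have hj : ∀ j ∈ Finset.range d, (wt (N / 2) q j : ℝ) *
      (Real.exp (σ / M * clip M (z j * (q j * N / wt (N / 2) q j))) - 1) ≤
      N * (σ / M * (q j * z j) + 4 / M ^ 2 * z j ^ 2) := by
    intro j _
    set w : ℝ := ((wt (N / 2) q j : ℕ) : ℝ) with hw
    have hw0 : 0 ≤ w := by positivity
    have hwq : (N : ℝ) / 2 * (q j * q j) ≤ w := Nat.le_ceil _
    -- A coordinate of weight zero is never sampled, but then `N * q j = 0`, so its share of the
    -- right-hand inner product is zero as well.
    rcases hw0.eq_or_lt with hz | hpos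
    · rw [← hz] at hwq ⊢
      have hNq : N * q j = 0 := by
        have h := mul_self_nonneg (q j)
        rcases Nat.eq_zero_or_pos N with h' | h'
        · simp [h']
        · have h'' : (0 : ℝ) < N := by exact_mod_cast h'
          have : q j * q j = 0 := by
            nlinarith
          rw [mul_self_eq_zero.1 this, mul_zero]
      have : N * (σ / M * (q j * z j) + 4 / M ^ 2 * z j ^ 2) = N * (4 / M ^ 2 * z j ^ 2) := by
        linear_combination σ / M * z j * hNq
      rw [this, zero_mul]; positivity
    · have h1 := mul_le_mul_of_nonneg_left
        (sub_le_sub_right (exp_clip_le hM hσ (z j * (q j * N / w))) 1) hw0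
      refine h1.trans ?_
      -- The last factor isolates the ratio of the unrounded to the rounded weight, which is at most
      -- 1.
      have e : w * (1 + σ / M * (z j * (q j * N / w)) + 2 * (z j * (q j * N / w) / M) ^ 2 - 1) =
          N * (σ / M * (q j * z j)) + N * (4 / M ^ 2 * z j ^ 2) * (N / 2 * (q j * q j) / w) := by
        field_simp; ring
      rw [e, mul_add]
      have h2 : N / 2 * (q j * q j) / w ≤ 1 := (div_le_one hpos).2 hwq
      have h3 : 0 ≤ N * (4 / M ^ 2 * z j ^ 2) := by positivity
      nlinarith
  have h := Finset.sum_le_sum hj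
  rw [← Finset.mul_sum, Finset.sum_add_distrib, ← Finset.mul_sum, ← Finset.mul_sum] at h
  have h4 : 4 / M ^ 2 * ∑ j ∈ Finset.range d, z j ^ 2 ≤ 4 * D ^ 2 / M ^ 2 := by
    have := mul_le_mul_of_nonneg_left hz (show 0 ≤ 4 / M ^ 2 by positivity)
    calc _ ≤ _ := this
      _ = _ := by ring
  have h5 := Real.add_one_le_exp (σ / M * ∑ j ∈ Finset.range d, q j * z j + 4 * D ^ 2 / M ^ 2)
  have h6 : (0 : ℝ) ≤ N := by positivity
  calc _ ≤ (N : ℝ) + N * (σ / M * ∑ j ∈ Finset.range d, q j * z j +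
        4 / M ^ 2 * ∑ j ∈ Finset.range d, z j ^ 2) := by linarith
    _ ≤ N * (σ / M * ∑ j ∈ Finset.range d, q j * z j + 4 * D ^ 2 / M ^ 2 + 1) := by nlinarith
    _ ≤ _ := mul_le_mul_of_nonneg_left h5 h6

/-! ### The potential as a supermartingale -/

/-- Exponential potential of the deviations after `k` samples. -/
noncomputable def pot (n : ℕ) (M D : ℝ) (ip : ℕ → ℝ) (k : ℕ) (A : ℕ → ℝ) : ℝ :=
  ∑ i ∈ Finset.range n,
    (Real.exp (1 / M * (A i - k * ip i) - k * (4 * D ^ 2 / M ^ 2)) +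
      Real.exp (-1 / M * (A i - k * ip i) - k * (4 * D ^ 2 / M ^ 2)))

lemma pot_nonneg (n : ℕ) (M D : ℝ) (ip : ℕ → ℝ) (k : ℕ) (A : ℕ → ℝ) : 0 ≤ pot n M D ip k A :=
  Finset.sum_nonneg fun _ _ => by positivity

lemma pot_congr {n : ℕ} {M D : ℝ} {ip : ℕ → ℝ} {k : ℕ} {A B : ℕ → ℝ} (h : ∀ i < n, A i = B i) :
    pot n M D ip k A = pot n M D ip k B :=
  Finset.sum_congr rfl fun i hi => by rw [h i (Finset.mem_range.1 hi)]

lemma pot_zero (n : ℕ) (M D : ℝ) (ip : ℕ → ℝ) {A : ℕ → ℝ} (hA : ∀ i < n, A i = 0) :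
    pot n M D ip 0 A = 2 * n := by
  rw [pot_congr hA]
  simp [pot]; ring

/-- The supermartingale property: the term `4 * D ^ 2 / M ^ 2` subtracted per sample in `pot` is
exactly the growth allowed by `sum_exp_contrib_le`. The same `u` serves all points; linearity over
`i` makes their dependence irrelevant. -/
lemma sum_pot_le {n N d : ℕ} {M D : ℝ} {q : ℕ → ℝ} {X : ℕ → ℕ → ℝ} (hM : 0 < M)
    (hN : 2 * d ≤ N) (hq : ∑ j ∈ Finset.range d, q j ^ 2 ≤ 1)
    (hX : ∀ i < n, ∑ j ∈ Finset.range d, X i j ^ 2 ≤ D ^ 2) (k : ℕ) (A : ℕ → ℝ) :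
    ∑ u ∈ Finset.range N, pot n M D (fun i => ∑ j ∈ Finset.range d, q j * X i j) (k + 1)
        (fun i => A i + contrib N M q (X i) d u) ≤
      N * pot n M D (fun i => ∑ j ∈ Finset.range d, q j * X i j) k A := by
  unfold pot
  rw [Finset.sum_comm, Finset.mul_sum]
  refine Finset.sum_le_sum fun i hi => ?_
  set ip := ∑ j ∈ Finset.range d, q j * X i j with hip
  have key : ∀ σ : ℝ, σ ^ 2 = 1 → ∑ u ∈ Finset.range N,
      Real.exp (σ / M * (A i + contrib N M q (X i) d u - (k + 1 : ℕ) * ip) -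
        (k + 1 : ℕ) * (4 * D ^ 2 / M ^ 2)) ≤
      N * Real.exp (σ / M * (A i - k * ip) - k * (4 * D ^ 2 / M ^ 2)) := by
    intro σ hσ
    have h := sum_exp_contrib_le hM hσ hN hq (hX i (Finset.mem_range.1 hi))
    rw [← hip] at h
    set E := Real.exp (σ / M * (A i - (k + 1) * ip) - (k + 1) * (4 * D ^ 2 / M ^ 2)) with hE
    have e1 : ∀ u ∈ Finset.range N, Real.exp (σ / M * (A i + contrib N M q (X i) d u -
        (k + 1 : ℕ) * ip) - (k + 1 : ℕ) * (4 * D ^ 2 / M ^ 2)) =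
        Real.exp (σ / M * contrib N M q (X i) d u) * E := by
      intro u _
      rw [hE, ← Real.exp_add]; push_cast; congr 1; ring
    rw [Finset.sum_congr rfl e1, ← Finset.sum_mul]
    calc _ ≤ N * Real.exp (σ / M * ip + 4 * D ^ 2 / M ^ 2) * E :=
          mul_le_mul_of_nonneg_right h (Real.exp_pos _).le
      _ = _ := by rw [mul_assoc, hE, ← Real.exp_add]; congr 2; ring
  rw [Finset.sum_add_distrib, mul_add]
  exact add_le_add (key 1 (by norm_num)) (key (-1) (by norm_num))

/-- A deviation of `m * ε` in one accumulator makes a single summand of the potential at least `exp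
r`, hence at least `2 ^ r ≥ 2 * n / δ`. The prefactor `δ / (2 * n)` brings this to 1. -/
lemma one_le_pot {n m r K : ℕ} {D ε δ : ℝ} {ip A : ℕ → ℝ} (hD : 0 < D) (hε : 0 < ε) (hδ : 0 < δ)
    (hK : 16 * D ^ 2 / ε ^ 2 ≤ K) (hm : m = K * r) (hr : 2 * n ≤ δ * 2 ^ r) (hm0 : 0 < m)
    {i : ℕ} (hi : i < n) (hbad : ¬ (ip i - ε ≤ A i / m ∧ A i / m ≤ ip i + ε)) :
    1 ≤ δ / (2 * n) * pot n (8 * D ^ 2 / ε) D ip m A := by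
  have hmpos : (0 : ℝ) < m := by exact_mod_cast hm0
  have hn : (0 : ℝ) < n := by exact_mod_cast (by omega : 0 < n)
  set M := 8 * D ^ 2 / ε with hM
  have hM0 : 0 < M := by positivity
  -- `M = 8 * D ^ 2 / ε` maximizes `ε / M - 4 * D ^ 2 / M ^ 2`; the maximum `ε ^ 2 / (16 * D ^ 2)`
  -- explains the number `K` of samples per factor of confidence.
  have e1 : (m : ℝ) * ε / M - m * (4 * D ^ 2 / M ^ 2) = m * (ε ^ 2 / (16 * D ^ 2)) := by
    rw [hM]; field_simp; ring
  have h2 : (r : ℝ) ≤ m * (ε ^ 2 / (16 * D ^ 2)) := by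
    rw [hm]; push_cast
    have h3 : 1 ≤ K * (ε ^ 2 / (16 * D ^ 2)) := by
      calc (1 : ℝ) = 16 * D ^ 2 / ε ^ 2 * (ε ^ 2 / (16 * D ^ 2)) := by field_simp
        _ ≤ _ := mul_le_mul_of_nonneg_right hK (by positivity)
    nlinarith [Nat.cast_nonneg (α := ℝ) r]
  have h3 : (2 : ℝ) ^ r ≤ Real.exp (m * ε / M - m * (4 * D ^ 2 / M ^ 2)) := by
    rw [e1]
    calc (2 : ℝ) ^ r ≤ Real.exp 1 ^ r :=
          pow_le_pow_left₀ (by norm_num) (by linarith [Real.add_one_le_exp 1]) _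
      _ = Real.exp r := by rw [← Real.exp_nat_mul, mul_one]
      _ ≤ _ := Real.exp_le_exp.2 h2
  have h4 : Real.exp (m * ε / M - m * (4 * D ^ 2 / M ^ 2)) ≤ pot n M D ip m A := by
    refine le_trans ?_ (Finset.single_le_sum (fun _ _ => by positivity) (Finset.mem_range.2 hi))
    rw [not_and_or, not_le, not_le] at hbad
    rcases hbad with h | h
    · rw [div_lt_iff₀ hmpos] at h
      refine le_add_of_nonneg_of_le (Real.exp_pos _).le (Real.exp_le_exp.2 ?_)
      refine sub_le_sub_right ?_ _
      calc m * ε / M ≤ (-(A i - m * ip i)) / M := div_le_div_of_nonneg_right (by linarith) hM0.le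
        _ = _ := by ring
    · rw [lt_div_iff₀ hmpos] at h
      refine le_add_of_le_of_nonneg (Real.exp_le_exp.2 ?_) (Real.exp_pos _).le
      refine sub_le_sub_right ?_ _
      calc m * ε / M ≤ (A i - m * ip i) / M := div_le_div_of_nonneg_right (by linarith) hM0.le
        _ = _ := by ring
  have h5 := h3.trans h4
  calc (1 : ℝ) = δ / (2 * n) * (2 * n / δ) := by field_simp
    _ ≤ δ / (2 * n) * 2 ^ r := by
      refine mul_le_mul_of_nonneg_left ?_ (by positivity)
      rw [div_le_iff₀ hδ]; linarith
    _ ≤ _ := mul_le_mul_of_nonneg_left h5 (by positivity)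

end IPE

/-! ### Reading cells after a write -/

namespace RealRAM

variable {s : State} {a b x : ℕ} {y : ℝ}

@[simp] lemma State.setInt_int : (s.setInt a x).mem.int b = if b = a then x else s.mem.int b := by
  simp [State.setInt, Function.update_apply]

@[simp] lemma State.setInt_real : (s.setInt a x).mem.real = s.mem.real := rfl
@[simp] lemma State.setInt_realIn : (s.setInt a x).realIn = s.realIn := rfl
@[simp] lemma State.setInt_intIn : (s.setInt a x).intIn = s.intIn := rfl
@[simp] lemma State.setInt_out : (s.setInt a x).out = s.out := rfl

@[simp] lemma State.setReal_real :
    (s.setReal a y).mem.real b = if b = a then y else s.mem.real b := by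
  simp [State.setReal, Function.update_apply]

@[simp] lemma State.setReal_int : (s.setReal a y).mem.int = s.mem.int := rfl
@[simp] lemma State.setReal_realIn : (s.setReal a y).realIn = s.realIn := rfl
@[simp] lemma State.setReal_intIn : (s.setReal a y).intIn = s.intIn := rfl
@[simp] lemma State.setReal_out : (s.setReal a y).out = s.out := rfl

end RealRAM

namespace IPE

open RealRAM

/-! ### Memory layout -/

/-- Parameters of the data structure: number of points, dimension, number of samples per query,
number of coins per sample, truncation threshold. -/
structure Params where
  (n d m b : ℕ)
  M : ℝ

/-- The parameters are admissible for memory size `S`. -/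
structure Params.Fit (π : Params) (S : ℕ) : Prop where
  d_pos : 0 < π.d
  two_d : 2 * π.d ≤ 2 ^ π.b
  size : π.n * π.d + π.n + π.m + π.b + 2 ^ π.b + 64 ≤ S

/-- The memory holds the parameters and the points `X`. -/
structure Core (π : Params) (X : ℕ → ℕ → ℝ) (μ : Memory) : Prop where
  n : μ.int 2 = π.n
  d : μ.int 3 = π.d
  m : μ.int 4 = π.m
  b : μ.int 5 = π.b
  N : μ.int 6 = 2 ^ π.b
  H : μ.real 0 = ((2 ^ π.b : ℕ) : ℝ) / 2
  M : μ.real 1 = π.M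
  negM : μ.real 2 = -π.M
  pts : ∀ i < π.n, ∀ j < π.d, μ.real (16 + (i * π.d + j)) = X i j

/-- The accumulators for the estimates. -/
def acc (π : Params) (m : Memory) (i : ℕ) : ℝ := m.real (16 + π.n * π.d + i)

variable {π : Params} {X : ℕ → ℕ → ℝ} {s : State} {S : ℕ}

lemma index_lt {n d i j : ℕ} (hi : i < n) (hj : j < d) : i * d + j < n * d := by
  have := Nat.mul_le_mul_right d (Nat.succ_le_of_lt hi)
  rw [Nat.succ_mul] at this
  omega

lemma index_inj {d i j i' j' : ℕ} (hj : j < d) (hj' : j' < d) (h : i * d + j = i' * d + j') :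
    i = i' ∧ j = j' := by
  have hd : 0 < d := by omega
  have h1 := congrArg (· / d) h
  have h2 := congrArg (· % d) h
  simp only [mul_comm _ d, Nat.mul_add_div hd, Nat.div_eq_of_lt hj, Nat.div_eq_of_lt hj',
    Nat.mul_add_mod, Nat.mod_eq_of_lt hj, Nat.mod_eq_of_lt hj', add_zero] at h1 h2
  exact ⟨h1, h2⟩

/-- Integer cells 2 to 6 are reserved for the parameters. In the real bank the cells 0 to 2 are
reserved, 3 to 15 are scratch, and the points start at 16, followed by the accumulators. -/
lemma Core.setInt (h : Core π X s.mem) {a x : ℕ} (ha : a < 2 ∨ 6 < a) :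
    Core π X (s.setInt a x).mem where
  n := by rw [State.setInt_int, if_neg (by omega), h.n]
  d := by rw [State.setInt_int, if_neg (by omega), h.d]
  m := by rw [State.setInt_int, if_neg (by omega), h.m]
  b := by rw [State.setInt_int, if_neg (by omega), h.b]
  N := by rw [State.setInt_int, if_neg (by omega), h.N]
  H := h.H
  M := h.M
  negM := h.negM
  pts := h.pts

lemma Core.setReal (h : Core π X s.mem) {a : ℕ} {x : ℝ}
    (ha : 3 ≤ a ∧ a < 16 ∨ 16 + π.n * π.d ≤ a) : Core π X (s.setReal a x).mem where
  n := h.n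
  d := h.d
  m := h.m
  b := h.b
  N := h.N
  H := by rw [State.setReal_real, if_neg (by omega), h.H]
  M := by rw [State.setReal_real, if_neg (by omega), h.M]
  negM := by rw [State.setReal_real, if_neg (by omega), h.negM]
  pts i hi j hj := by
    have := index_lt hi hj
    rw [State.setReal_real, if_neg (by omega), h.pts i hi j hj]

@[simp] lemma acc_setInt {a x : ℕ} : acc π (s.setInt a x).mem = acc π s.mem := rfl

lemma acc_setReal {a : ℕ} {x : ℝ} (ha : a < 16) : acc π (s.setReal a x).mem = acc π s.mem := by
  funext i
  rw [acc, State.setReal_real, if_neg (by omega), acc]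

/-- What does not change while a sample is drawn. -/
structure Ctx (π : Params) (X : ℕ → ℕ → ℝ) (q : ℕ → ℝ) (k : ℕ) (A : ℕ → ℝ) (s : State) : Prop where
  core : Core π X s.mem
  q : s.realIn = q
  k : s.mem.int 7 = k
  acc : acc π s.mem = A

variable {q : ℕ → ℝ} {k : ℕ} {A : ℕ → ℝ}

lemma Ctx.setInt (h : Ctx π X q k A s) {a x : ℕ} (ha : a < 2 ∨ 7 < a) :
    Ctx π X q k A (s.setInt a x) where
  core := h.core.setInt (by omega)
  q := h.q
  k := by rw [State.setInt_int, if_neg (by omega), h.k]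
  acc := h.acc

lemma Ctx.setReal (h : Ctx π X q k A s) {a : ℕ} {x : ℝ} (ha : 3 ≤ a ∧ a < 16) :
    Ctx π X q k A (s.setReal a x) where
  core := h.core.setReal (.inl ha)
  q := h.q
  k := h.k
  acc := by rw [acc_setReal ha.2, h.acc]

/-! ### Drawing a random number -/

/-- `M[9]` becomes a random number of `M[5]` bits. -/
def bitsCmd : Cmd :=
  forLoop 8 5 (.seq (block [.intAdd 9 9 9]) (.seq (.flip 12) (block [.intAdd 9 9 12])))

/-- Average of `G` over the numbers that begin with `u`, followed by `t` more bits. -/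
noncomputable def avg (G : ℕ → ℝ≥0∞) (t u : ℕ) : ℝ≥0∞ :=
  ((2 : ℝ≥0∞) ^ t)⁻¹ * ∑ v ∈ Finset.range (2 ^ t), G (u * 2 ^ t + v)

lemma avg_zero (G : ℕ → ℝ≥0∞) (u : ℕ) : avg G 0 u = G u := by simp [avg]

/-- Split the continuations of `u` by their next bit, which turns `u` into `2 * u` or `2 * u + 1`.
-/
lemma avg_succ (G : ℕ → ℝ≥0∞) (t u : ℕ) :
    avg G (t + 1) u = 2⁻¹ * (avg G t (u + u) + avg G t (u + u + 1)) := by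
  unfold avg
  rw [← mul_add, ← mul_assoc, ← ENNReal.mul_inv (by simp) (by simp), ← pow_succ',
    show 2 ^ (t + 1) = 2 ^ t + 2 ^ t by ring, Finset.sum_range_add]
  congr 2
  · exact Finset.sum_congr rfl fun v _ => by congr 1; ring
  · exact Finset.sum_congr rfl fun v _ => by congr 1; ring

/-- After `t` flips the value is the average of `G` over all completions of the bits drawn so far;
by `avg_succ` a flip preserves it on average. Thus `M[9]` acts as a uniform number below `2 ^ π.b`.
-/
lemma bitsCmd_spec (hπ : π.Fit S) (hs : s.mem.Fits S) (h : Ctx π X q k A s)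
    (h9 : s.mem.int 9 = 0) (G : ℕ → ℝ≥0∞) :
    Tri S (13 * π.b + 3) bitsCmd s (avg G π.b 0)
      (fun s => Ctx π X q k A s ∧ s.mem.int 9 < 2 ^ π.b) (fun s => G (s.mem.int 9)) := by
  have hS := hπ.size
  have hp := Nat.two_pow_pos π.b
  refine (Tri.forLoop (S := S) (a := 8) (b := 5) π.b (fun _ => 7)
    (fun t s => Ctx π X q k A s ∧ s.mem.int 9 < 2 ^ t) (fun t s => avg G (π.b - t) (s.mem.int 9))
    hs (by omega) (by omega) (by omega) (by omega) (by omega) h.core.b ⟨h, by simp [h9]⟩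
    (by simp [h9]) ?_ ?_ ?_ le_rfl).mono ?_ le_rfl (fun _ h => h) ?_
  · intro k s c x hc hI
    refine ⟨hI.1.setInt (by omega), ?_⟩
    rw [State.setInt_int, if_neg (by omega)]; exact hI.2
  · intro k s c x hc
    rw [State.setInt_int, if_neg (by omega)]
  · intro t ht s hs hI h8 h5
    set u := s.mem.int 9 with hu
    have hut : u < 2 ^ t := hI.2
    have hpow : 2 ^ (t + 1) ≤ 2 ^ π.b := Nat.pow_le_pow_right (by norm_num) ht
    rw [pow_succ] at hpow
    have e : π.b - t = (π.b - (t + 1)) + 1 := by omega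
    refine Tri.seq (T₁ := 2) (T₂ := 4) (Q := fun s => Ctx π X q k A s ∧ s.mem.int 9 = u + u ∧
      s.mem.int 8 = t ∧ s.mem.int 5 = π.b) (g := fun _ => avg G (π.b - t) u) hs
      (Det.of_block (by simp) hs ?_ (by simp) _) ?_ le_rfl
    · simp only [blockWP, Instr.Ok, Instr.exec]
      refine ⟨⟨by omega, by omega⟩, hI.1.setInt (by omega), by simp [hu], by simp [h8],
        by simp [h5]⟩
    · intro s₁ hs₁ h₁
      refine Tri.seq (T₁ := 1) (T₂ := 2) (Q := fun s => Ctx π X q k A s ∧ s.mem.int 9 = u + u ∧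
        s.mem.int 8 = t ∧ s.mem.int 5 = π.b ∧ s.mem.int 12 ≤ 1)
        (g := fun s => avg G (π.b - (t + 1)) (u + u + s.mem.int 12)) hs₁
        (Tri.flip hs₁ (by omega) (by omega) ?_ ?_ ?_) ?_ le_rfl
      · exact ⟨h₁.1.setInt (by omega), by simp [h₁.2.1], by simp [h₁.2.2.1], by simp [h₁.2.2.2],
          by simp⟩
      · exact ⟨h₁.1.setInt (by omega), by simp [h₁.2.1], by simp [h₁.2.2.1], by simp [h₁.2.2.2],
          by simp⟩
      · rw [e, avg_succ]
        simp
      · intro s₂ hs₂ h₂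
        obtain ⟨c₂, h9, h8, h5, h12⟩ := h₂
        refine Tri.of_block (by simp) hs₂ ?_ (by simp)
        simp only [blockWP, Instr.Ok, Instr.exec]
        refine ⟨⟨by omega, by omega⟩, ⟨⟨c₂.setInt (by omega), ?_⟩, by simp [h8], by simp [h5]⟩,
          by simp [h9]⟩
        simp only [State.setInt_int, if_true, pow_succ]; omega
  · simp; omega
  · intro s _; simp [avg_zero]

end IPE

namespace IPE

open RealRAM

variable {π : Params} {X : ℕ → ℕ → ℝ} {s : State} {S : ℕ} {q : ℕ → ℝ} {k : ℕ} {A : ℕ → ℝ}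

/-! ### Drawing a sample -/

/-- Stands for an absent `else` branch; there is no empty command, so it clears the scratch cell 0.
-/
def skip : Cmd := block [.intConst 0 0]

lemma skip_spec {Q : State → Prop} (hs : s.mem.Fits S) (h0 : 0 < S) (h : Q (s.setInt 0 0)) :
    Det S 2 skip s Q :=
  Det.of_block (by simp) hs ⟨⟨h0, h0⟩, h⟩ le_rfl

/-- Examine the coordinate `M[8]`: if the random number `M[9]` is among its weight many numbers
from `M[10]` on, then `M[11]` becomes this coordinate, and `R[3]` its factor. -/
def walkBody : Cmd :=
  .seq (block [.readReal 4 8, .realMul 5 4 4, .realMul 5 0 5, .intConst 13 0, .realConst 6 0])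
    (.seq (.loop (.realLt 6 5) (block [.intConst 1 1, .intAdd 13 13 1, .realOfInt 6 13]))
      (.seq (block [.intAdd 12 10 13])
        (.seq
          (.ite (.intLe 10 9)
            (.ite (.intLt 9 12)
              (block [.intConst 0 0, .intAdd 11 8 0, .realOfInt 6 6, .realMul 3 4 6,
                .realOfInt 6 13, .realDiv 3 3 6])
              skip)
            skip)
          (block [.intConst 0 0, .intAdd 10 12 0]))))

/-- State after `j` coordinates have been examined. -/
structure WalkInv (π : Params) (X : ℕ → ℕ → ℝ) (q : ℕ → ℝ) (k : ℕ) (A : ℕ → ℝ) (u j : ℕ)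
    (s : State) : Prop where
  ctx : Ctx π X q k A s
  u_eq : s.mem.int 9 = u
  c : s.mem.int 10 = pre ((2 ^ π.b : ℕ) / 2) q j
  sel_eq : (s.mem.int 11, s.mem.real 3) = sel (2 ^ π.b) ((2 ^ π.b : ℕ) / 2) q u j

lemma WalkInv.setInt {u j : ℕ} (h : WalkInv π X q k A u j s) {a x : ℕ}
    (ha : a < 2 ∨ a = 8 ∨ 11 < a) : WalkInv π X q k A u j (s.setInt a x) where
  ctx := h.ctx.setInt (by omega)
  u_eq := by rw [State.setInt_int, if_neg (by omega), h.u_eq]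
  c := by rw [State.setInt_int, if_neg (by omega), h.c]
  sel_eq := by rw [State.setInt_int, if_neg (by omega), State.setInt_real, h.sel_eq]

lemma WalkInv.setReal {u j : ℕ} (h : WalkInv π X q k A u j s) {a : ℕ} {x : ℝ}
    (ha : 3 < a ∧ a < 16) : WalkInv π X q k A u j (s.setReal a x) where
  ctx := h.ctx.setReal (by omega)
  u_eq := h.u_eq
  c := h.c
  sel_eq := by rw [State.setReal_real, if_neg (by omega), State.setReal_int, h.sel_eq]

/-- The machine cannot round, so the ceiling is found by counting up to `H * q j ^ 2`. This costs
time proportional to the weight, which is affordable because all weights together are at most `2 ^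
π.b`. -/
lemma walkBody_spec {u j : ℕ} (hπ : π.Fit S) (hq : ∑ i ∈ Finset.range π.d, q i ^ 2 ≤ 1)
    (hs : s.mem.Fits S) (h : WalkInv π X q k A u j s) (hj : j < π.d) (h8 : s.mem.int 8 = j) :
    Det S (36 + 7 * wt ((2 ^ π.b : ℕ) / 2) q j) walkBody s
      (fun s => WalkInv π X q k A u (j + 1) s ∧ s.mem.int 8 = j ∧ s.mem.int 3 = π.d) := by
  have hS := hπ.size
  have hp := Nat.two_pow_pos π.b
  set H : ℝ := (2 ^ π.b : ℕ) / 2 with hH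
  -- This keeps the weight counter and the running total within the word size.
  have hpre : pre H q (j + 1) ≤ 2 ^ π.b :=
    (pre_mono H q (Nat.succ_le_of_lt hj)).trans (pre_le hq hπ.two_d)
  rw [pre_succ] at hpre
  refine Det.seq (T₁ := 10) (T₂ := 25 + 7 * wt H q j) (Q := fun s => WalkInv π X q k A u j s ∧
    s.mem.int 8 = j ∧ s.mem.real 4 = q j ∧ s.mem.real 5 = H * (q j * q j) ∧ s.mem.int 13 = 0 ∧
    s.mem.real 6 = 0) hs (Det.of_block (by simp) hs ?_ (by simp)) ?_ (by omega)
  · simp only [blockWP, Instr.Ok, Instr.exec]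
    refine ⟨by omega, by omega, by omega, by omega, by omega, ?_⟩
    refine ⟨.setReal (.setInt (.setReal (.setReal (.setReal h ?_) ?_) ?_) ?_) ?_, ?_⟩
    · omega
    · omega
    · omega
    · omega
    · omega
    · simp [h8, h.ctx.q, h.ctx.core.H, hH]
  intro s hs h
  refine Det.seq (T₁ := 7 * wt H q j + 1) (T₂ := 23) (Q := fun s => WalkInv π X q k A u j s ∧
    s.mem.int 8 = j ∧ s.mem.real 4 = q j ∧ s.mem.int 13 = wt H q j) hs ?_ ?_ (by omega)
  · refine (Det.loop (wt H q j) 6 (fun i s => WalkInv π X q k A u j s ∧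
      s.mem.int 8 = j ∧ s.mem.real 4 = q j ∧ s.mem.real 5 = H * (q j * q j) ∧ s.mem.int 13 = i ∧
      s.mem.real 6 = i) hs (by simpa using h) ?_ ?_ ?_ le_rfl).mono (by omega) ?_
    · intro i hi s h
      simp only [Test.holds, h.2.2.2.1, h.2.2.2.2.2]
      exact Nat.lt_ceil.1 hi
    · intro s h
      simp only [Test.holds, h.2.2.2.1, h.2.2.2.2.2, not_lt]
      exact Nat.le_ceil _
    · intro i hi s hs h
      obtain ⟨hw, h8, h4, h5, h13, h6⟩ := h
      refine Det.of_block (by simp) hs ?_ (by simp)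
      simp only [blockWP, Instr.Ok, Instr.exec]
      refine ⟨by omega, ⟨by omega, by simp [h13]; omega⟩, by omega,
        .setReal (.setInt (.setInt hw ?_) ?_) ?_, ?_⟩
      · omega
      · omega
      · omega
      · simp [h13, h8, h4, h5]
    · rintro s ⟨h1, h2, h3, -, h4, -⟩
      exact ⟨h1, h2, h3, h4⟩
  intro s hs h
  obtain ⟨hw, h8, h4, h13⟩ := h
  refine Det.seq (T₁ := 2) (T₂ := 20) (Q := fun s => WalkInv π X q k A u j s ∧
    s.mem.int 8 = j ∧ s.mem.real 4 = q j ∧ s.mem.int 13 = wt H q j ∧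
    s.mem.int 12 = pre H q (j + 1)) hs (Det.of_block (by simp) hs ?_ (by simp)) ?_ (by omega)
  · have hc := hw.c
    rw [← hH] at hc
    simp only [blockWP, Instr.Ok, Instr.exec, hc, h13]
    exact ⟨⟨by omega, by omega⟩, hw.setInt (by omega), by simp [h8], by simp [h4], by simp [h13],
      by simp [pre_succ]⟩
  intro s hs h
  obtain ⟨hw, h8, h4, h13, h12⟩ := h
  have hc : s.mem.int 10 = pre H q j := hw.c
  refine Det.seq (T₁ := 15) (T₂ := 4) (Q := fun s => Ctx π X q k A s ∧ s.mem.int 9 = u ∧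
    s.mem.int 8 = j ∧ s.mem.int 12 = pre H q (j + 1) ∧
    (s.mem.int 11, s.mem.real 3) = sel (2 ^ π.b) H q u (j + 1)) hs ?_ ?_ (by omega)
  · refine Det.ite (T₁ := 14) hs (fun hb => Det.ite (T₁ := 12) hs ?_ ?_ (by omega)) ?_ (by omega)
    · intro hb'
      simp only [Test.holds, hc, hw.u_eq, h12] at hb hb'
      refine Det.of_block (by simp) hs ?_ (by simp)
      simp only [blockWP, Instr.Ok, Instr.exec]
      refine ⟨by omega, ⟨by omega, by simp [h8]; have := (hs 8).1; omega⟩, by omega, by omega, by omega, by omega,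
        .setReal (.setReal (.setReal (.setReal (.setInt (.setInt hw.ctx ?_) ?_) ?_) ?_) ?_) ?_, ?_⟩
      · omega
      · omega
      · omega
      · omega
      · omega
      · omega
      · simp [hw.u_eq, h8, h12, sel, hb, hb', h4, h13, hw.ctx.core.N]
    · intro hb'
      simp only [Test.holds, hc, hw.u_eq, h12] at hb hb'
      refine (skip_spec hs (by omega) ?_).mono (by omega) fun _ h => h
      refine ⟨hw.ctx.setInt (by omega), by simp [hw.u_eq], by simp [h8], by simp [h12], ?_⟩
      rw [sel, if_neg (by omega), ← hw.sel_eq]; simp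
    · intro hb
      simp only [Test.holds, hc, hw.u_eq] at hb
      refine (skip_spec hs (by omega) ?_).mono (by omega) fun _ h => h
      refine ⟨hw.ctx.setInt (by omega), by simp [hw.u_eq], by simp [h8], by simp [h12], ?_⟩
      rw [sel, if_neg (by omega), ← hw.sel_eq]; simp
  intro s hs h
  obtain ⟨hctx, h9, h8, h12, hsel⟩ := h
  refine Det.of_block (by simp) hs ?_ (by simp)
  simp only [blockWP, Instr.Ok, Instr.exec]
  refine ⟨by omega, ⟨by omega, ?_⟩, ⟨(hctx.setInt ?_).setInt ?_, ?_, ?_, ?_⟩, ?_, ?_⟩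
  · simp [h12]; rw [pre_succ]; omega
  · omega
  · omega
  · simp [h9]
  · simp [h12, hH]
  · simpa [hH] using hsel
  · simp [h8]
  · simp [hctx.core.d]

/-- Add the contribution of the sample `M[11]`, with factor `R[3]`, to the `M[8]`-th accumulator. -/
def addBody : Cmd :=
  .seq (block [.intMul 12 8 3, .intAdd 12 12 11, .intConst 13 16, .intAdd 12 13 12,
      .realLoad 4 12, .realMul 4 4 3])
    (.ite (.realLe 4 1)
      (.ite (.realLe 2 4)
        (block [.intMul 12 2 3, .intConst 13 16, .intAdd 12 13 12, .intAdd 12 12 8,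
          .realLoad 5 12, .realAdd 5 5 4, .realStore 12 5])
        skip)
      skip)

/-- State after the contributions to `i` accumulators have been added. -/
structure AddInv (π : Params) (X : ℕ → ℕ → ℝ) (q : ℕ → ℝ) (k : ℕ) (A : ℕ → ℝ) (J : ℕ) (g : ℝ)
    (i : ℕ) (s : State) : Prop where
  core : Core π X s.mem
  q : s.realIn = q
  k : s.mem.int 7 = k
  J_eq : s.mem.int 11 = J
  g_eq : s.mem.real 3 = g
  acc : ∀ i' < π.n, acc π s.mem i' = A i' + if i' < i then clip π.M (X i' J * g) else 0

variable {J : ℕ} {g : ℝ} {i : ℕ}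

lemma AddInv.setInt (h : AddInv π X q k A J g i s) {a x : ℕ}
    (ha : a < 2 ∨ a = 8 ∨ 11 < a) : AddInv π X q k A J g i (s.setInt a x) where
  core := h.core.setInt (by omega)
  q := h.q
  k := by rw [State.setInt_int, if_neg (by omega), h.k]
  J_eq := by rw [State.setInt_int, if_neg (by omega), h.J_eq]
  g_eq := h.g_eq
  acc := h.acc

lemma AddInv.setReal (h : AddInv π X q k A J g i s) {a : ℕ} {x : ℝ}
    (ha : 3 < a ∧ a < 16) : AddInv π X q k A J g i (s.setReal a x) where
  core := h.core.setReal (by omega)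
  q := h.q
  k := h.k
  J_eq := h.J_eq
  g_eq := by rw [State.setReal_real, if_neg (by omega), h.g_eq]
  acc := by rw [acc_setReal ha.2]; exact h.acc

lemma AddInv.succ_of_clip_eq_zero (h : AddInv π X q k A J g i s)
    (h0 : clip π.M (X i J * g) = 0) : AddInv π X q k A J g (i + 1) s where
  core := h.core
  q := h.q
  k := h.k
  J_eq := h.J_eq
  g_eq := h.g_eq
  acc i' hi' := by
    rw [h.acc i' hi']
    rcases Nat.lt_trichotomy i' i with hh | hh | hh
    · rw [if_pos hh, if_pos (by omega)]
    · subst hh; simp [h0]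
    · rw [if_neg (by omega), if_neg (by omega)]

lemma AddInv.succ_of_store (h : AddInv π X q k A J g i s) {y : ℝ} (hi : i < π.n)
    (hy : y = A i + clip π.M (X i J * g)) :
    AddInv π X q k A J g (i + 1) (s.setReal (16 + π.n * π.d + i) y) where
  core := h.core.setReal (by omega)
  q := h.q
  k := h.k
  J_eq := h.J_eq
  g_eq := by rw [State.setReal_real, if_neg (by omega), h.g_eq]
  acc i' hi' := by
    have := h.acc i' hi'
    rw [IPE.acc] at this ⊢
    rw [State.setReal_real]
    rcases Nat.lt_trichotomy i' i with hh | hh | hh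
    · rw [if_neg (by omega), this, if_pos hh, if_pos (by omega)]
    · subst hh; simp [hy]
    · rw [if_neg (by omega), this, if_neg (by omega), if_neg (by omega)]

lemma addBody_spec (hπ : π.Fit S) (hs : s.mem.Fits S) (h : AddInv π X q k A J g i s)
    (hJ : J < π.d) (hi : i < π.n) (h8 : s.mem.int 8 = i) :
    Det S 29 addBody s (fun s => AddInv π X q k A J g (i + 1) s ∧ s.mem.int 8 = i ∧
      s.mem.int 2 = π.n) := by
  have hS := hπ.size
  have hp := Nat.two_pow_pos π.b
  have hidx := index_lt hi hJ
  refine Det.seq (T₁ := 12) (T₂ := 16) (Q := fun s => AddInv π X q k A J g i s ∧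
    s.mem.int 8 = i ∧ s.mem.real 4 = X i J * g) hs (Det.of_block (by simp) hs ?_ (by simp)) ?_
    (by omega)
  · simp only [blockWP, Instr.Ok, Instr.exec]
    refine ⟨⟨by omega, ?_⟩, ⟨by omega, ?_⟩, ⟨by omega, by omega⟩, ⟨by omega, ?_⟩, by omega,
      by omega, (((((h.setInt ?_).setInt ?_).setInt ?_).setInt ?_).setReal ?_).setReal ?_, ?_, ?_⟩
    · simp [h8, h.core.d]; omega
    · simp [h8, h.core.d, h.J_eq]; omega
    · simp [h8, h.core.d, h.J_eq]; omega
    any_goals omega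
    · simp [h8]
    · simp [h8, h.core.d, h.J_eq, h.g_eq, h.core.pts i hi J hJ]
  rintro s hs ⟨h, h8, h4⟩
  refine Det.ite (T₁ := 15) hs (fun hb => Det.ite (T₁ := 14) hs ?_ ?_ (by omega)) ?_ (by omega)
  · intro hb'
    simp only [Test.holds, h4, h.core.M, h.core.negM] at hb hb'
    have hc : clip π.M (X i J * g) = X i J * g := by rw [clip, if_pos hb, if_pos hb']
    refine Det.of_block (by simp) hs ?_ (by simp)
    simp only [blockWP, Instr.Ok, Instr.exec]
    have hacc := h.acc i hi
    rw [if_neg (by omega), add_zero, IPE.acc] at hacc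
    refine ⟨⟨by omega, ?_⟩, ⟨by omega, by omega⟩, ⟨by omega, ?_⟩, ⟨by omega, ?_⟩, by omega,
      by omega, ?_, ?_⟩
    · simp [h.core.n, h.core.d]; omega
    · simp [h.core.n, h.core.d]; omega
    · simp [h.core.n, h.core.d, h8]; omega
    · simp [h.core.n, h.core.d, h8]; omega
    · simp only [State.setInt_int, State.setReal_int, State.setInt_real, State.setReal_real,
        h.core.n, h.core.d, h8]
      norm_num
      refine AddInv.succ_of_store ((((((h.setInt ?_).setInt ?_).setInt ?_).setInt ?_).setReal
        ?_).setReal ?_) hi ?_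
      any_goals omega
      rw [hacc, h4, hc]
  · intro hb'
    simp only [Test.holds, h4, h.core.M, h.core.negM] at hb hb'
    have hc : clip π.M (X i J * g) = 0 := by rw [clip, if_pos hb, if_neg hb']
    exact (skip_spec hs (by omega) ⟨(h.succ_of_clip_eq_zero hc).setInt (by omega), by simp [h8],
      by simp [h.core.n]⟩).mono (by omega) fun _ h => h
  · intro hb
    simp only [Test.holds, h4, h.core.M] at hb
    have hc : clip π.M (X i J * g) = 0 := by rw [clip, if_neg hb]
    exact (skip_spec hs (by omega) ⟨(h.succ_of_clip_eq_zero hc).setInt (by omega), by simp [h8],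
      by simp [h.core.n]⟩).mono (by omega) fun _ h => h

/-- Select a coordinate by the random number `M[9]`, and add the contributions of this sample. -/
def selectCmd : Cmd :=
  .seq (block [.intConst 10 0, .intConst 11 0, .realConst 3 0])
    (.seq (forLoop 8 3 walkBody) (forLoop 8 2 addBody))

lemma selectCmd_spec (hπ : π.Fit S) (hq : ∑ i ∈ Finset.range π.d, q i ^ 2 ≤ 1)
    (hs : s.mem.Fits S) (h : Ctx π X q k A s) {u : ℕ} (hu : s.mem.int 9 = u) :
    Det S (42 * π.d + 7 * 2 ^ π.b + 35 * π.n + 14) selectCmd s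
      (fun s => Core π X s.mem ∧ s.realIn = q ∧ s.mem.int 7 = k ∧
        ∀ i < π.n, acc π s.mem i = A i + contrib (2 ^ π.b) π.M q (X i) π.d u) := by
  have hS := hπ.size
  have hp := Nat.two_pow_pos π.b
  have hpre := pre_le hq hπ.two_d
  refine Det.seq (T₁ := 6) (T₂ := 42 * π.d + 7 * 2 ^ π.b + 35 * π.n + 7)
    (Q := WalkInv π X q k A u 0) hs (Det.of_block (by simp) hs ?_ (by simp)) ?_ (by omega)
  · simp only [blockWP, Instr.Ok, Instr.exec]
    refine ⟨by omega, by omega, by omega, ((h.setInt ?_).setInt ?_).setReal ?_, ?_, ?_, ?_⟩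
    any_goals omega
    · simp [hu]
    · simp [pre]
    · simp [sel]
  intro s hs h
  refine Det.seq (T₁ := 42 * π.d + 7 * 2 ^ π.b + 3) (T₂ := 35 * π.n + 3)
    (Q := WalkInv π X q k A u π.d) hs (Det.forLoop π.d
      (fun j => 36 + 7 * wt ((2 ^ π.b : ℕ) / 2) q j) (WalkInv π X q k A u) hs (by omega) (by omega)
      (by omega) (by omega) (by omega) h.ctx.core.d h ?_ ?_ ?_) ?_ (by omega)
  · intro k s c x hc h
    exact h.setInt (by omega)
  · intro j hj s hs h h8 _
    exact walkBody_spec hπ hq hs h hj h8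
  -- The variable parts of the costs add up to the total weight, at most `2 ^ π.b`.
  · rw [Finset.sum_add_distrib, ← Finset.mul_sum]
    rw [pre] at hpre
    simp only [Finset.sum_const, Finset.card_range, smul_eq_mul]
    omega
  intro s hs h
  refine (Det.forLoop (S := S) π.n (fun _ => 29) (AddInv π X q k A
    (sel (2 ^ π.b) ((2 ^ π.b : ℕ) / 2) q u π.d).1
    (sel (2 ^ π.b) ((2 ^ π.b : ℕ) / 2) q u π.d).2) hs (by omega) (by omega) (by omega) (by omega)
    (by omega) h.ctx.core.n ?_ ?_ ?_ le_rfl).mono ?_ ?_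
  · refine ⟨h.ctx.core, h.ctx.q, h.ctx.k, ?_, ?_, ?_⟩
    · rw [← h.sel_eq]
    · rw [← h.sel_eq]
    · intro i _; rw [h.ctx.acc]; simp
  · intro k s c x hc h
    exact h.setInt (by omega)
  · intro i hi s hs h h8 h2
    exact addBody_spec hπ hs h (sel_fst_lt hπ.d_pos) hi h8
  · simp; omega
  · intro s h
    refine ⟨h.core, h.q, h.k, fun i hi => ?_⟩
    rw [h.acc i hi, if_pos hi, contrib]

/-! ### Queries -/

/-- Draw a random number, select a coordinate, and add the contributions. -/
def sampleCmd : Cmd := .seq (block [.intConst 9 0]) (.seq bitsCmd selectCmd)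

/-- All randomness of a sample sits in the number `u`; selection and accumulation are deterministic
given `u`. Expectations over coins thus become the plain average of `G` to which `sum_pot_le`
applies. -/
lemma sampleCmd_spec (hπ : π.Fit S) (hq : ∑ i ∈ Finset.range π.d, q i ^ 2 ≤ 1)
    (hs : s.mem.Fits S) (h : Ctx π X q k A s) {v : ℝ≥0∞} {g : State → ℝ≥0∞} (G : ℕ → ℝ≥0∞)
    (hv : avg G π.b 0 ≤ v)
    (hg : ∀ s', ∀ u < 2 ^ π.b, (∀ i < π.n, acc π s'.mem i =
      A i + contrib (2 ^ π.b) π.M q (X i) π.d u) → g s' ≤ G u) :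
    Tri S (13 * π.b + 42 * π.d + 7 * 2 ^ π.b + 35 * π.n + 21) sampleCmd s v
      (fun s => Core π X s.mem ∧ s.realIn = q ∧ s.mem.int 7 = k) g := by
  have hS := hπ.size
  have hp := Nat.two_pow_pos π.b
  refine Tri.seq (T₁ := 2) (T₂ := 13 * π.b + 42 * π.d + 7 * 2 ^ π.b + 35 * π.n + 18)
    (Q := fun s => Ctx π X q k A s ∧ s.mem.int 9 = 0) (g := fun _ => v) hs
    (Tri.of_block (by simp) hs ?_ (by simp)) ?_ (by omega)
  · simp only [blockWP, Instr.Ok, Instr.exec]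
    exact ⟨by omega, ⟨h.setInt (by omega), by simp⟩, le_rfl⟩
  rintro s hs ⟨h, h9⟩
  refine Tri.seq hs ((bitsCmd_spec hπ hs h h9 G).mono le_rfl hv (fun _ h => h) fun _ _ => le_rfl)
    ?_ (T₂ := 42 * π.d + 7 * 2 ^ π.b + 35 * π.n + 14) (by omega)
  rintro s hs ⟨h, h9⟩
  refine (Det.tri (g := g) (v := G (s.mem.int 9)) (selectCmd_spec hπ hq hs h rfl) ?_).mono
    le_rfl le_rfl ?_ (fun _ _ => le_rfl)
  · intro s' h'
    exact hg s' _ h9 h'.2.2.2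
  · intro s' h'
    exact ⟨h'.1, h'.2.1, h'.2.2.1⟩

/-- Write the `M[8]`-th estimate and reset its accumulator. -/
def outputBody : Cmd :=
  .seq (block [.intMul 12 2 3, .intConst 13 16, .intAdd 12 13 12, .intAdd 12 12 8, .realLoad 4 12,
    .realOfInt 5 4, .realDiv 6 4 5])
    (.seq (block [.write 8 6]) (block [.realConst 4 0, .realStore 12 4]))

/-- State after `i` estimates have been written. -/
structure OutInv (π : Params) (X : ℕ → ℕ → ℝ) (A : ℕ → ℝ) (i : ℕ) (s : State) : Prop where
  core : Core π X s.mem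
  out : ∀ i' < i, s.out i' = A i' / π.m
  acc : ∀ i' < π.n, acc π s.mem i' = if i' < i then 0 else A i'

lemma OutInv.setInt (h : OutInv π X A i s) {a x : ℕ} (ha : a < 2 ∨ 6 < a) :
    OutInv π X A i (s.setInt a x) where
  core := h.core.setInt (by omega)
  out := h.out
  acc := h.acc

lemma OutInv.setReal (h : OutInv π X A i s) {a : ℕ} {x : ℝ}
    (ha : 3 ≤ a ∧ a < 16) : OutInv π X A i (s.setReal a x) where
  core := h.core.setReal (by omega)
  out := h.out
  acc := by rw [acc_setReal ha.2]; exact h.acc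

lemma outputBody_spec (hπ : π.Fit S) (hs : s.mem.Fits S) (h : OutInv π X A i s)
    (hi : i < π.n) (h8 : s.mem.int 8 = i) :
    Det S 22 outputBody s (fun s => OutInv π X A (i + 1) s ∧ s.mem.int 8 = i ∧
      s.mem.int 2 = π.n) := by
  have hS := hπ.size
  have hp := Nat.two_pow_pos π.b
  have hacc := h.acc i hi
  rw [if_neg (by omega), IPE.acc] at hacc
  refine Det.seq (T₁ := 14) (T₂ := 7) (Q := fun s => OutInv π X A i s ∧ s.mem.int 8 = i ∧
    s.mem.int 12 = 16 + π.n * π.d + i ∧ s.mem.real 6 = A i / π.m) hs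
    (Det.of_block (by simp) hs ?_ (by simp)) ?_ (by omega)
  · simp only [blockWP, Instr.Ok, Instr.exec]
    refine ⟨⟨by omega, ?_⟩, ⟨by omega, by omega⟩, ⟨by omega, ?_⟩, ⟨by omega, ?_⟩, by omega,
      by omega, by omega, .setReal (.setReal (.setReal (.setInt (.setInt (.setInt (.setInt h ?_) ?_)
        ?_) ?_) ?_) ?_) ?_, ?_⟩
    · simp [h.core.n, h.core.d]; omega
    · simp [h.core.n, h.core.d]; omega
    · simp [h.core.n, h.core.d, h8]; omega
    any_goals omega
    simp [h.core.n, h.core.d, h.core.m, h8, hacc]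
  rintro s hs ⟨h, h8, h12, h6⟩
  refine Det.seq (T₁ := 2) (T₂ := 4) (Q := fun s => (Core π X s.mem ∧
    ∀ i' < π.n, acc π s.mem i' = if i' < i then 0 else A i') ∧
    (∀ i' < i + 1, s.out i' = A i' / π.m) ∧ s.mem.int 8 = i ∧
    s.mem.int 12 = 16 + π.n * π.d + i) hs (Det.of_block (by simp) hs ?_ (by simp)) ?_ (by omega)
  · simp only [blockWP, Instr.Ok, Instr.exec]
    refine ⟨trivial, ⟨h.core, h.acc⟩, ?_, h8, h12⟩
    intro i' hi'
    rw [Function.update_apply, h8, h6]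
    split_ifs with e
    · rw [e]
    · exact h.out i' (by omega)
  rintro s hs ⟨⟨hcore, ha⟩, hout, h8, h12⟩
  refine Det.of_block (by simp) hs ?_ (by simp)
  simp only [blockWP, Instr.Ok, Instr.exec, State.setReal_int, h12]
  refine ⟨by omega, by omega, ⟨(hcore.setReal ?_).setReal ?_, hout, ?_⟩, h8, hcore.n⟩
  · omega
  · omega
  · intro i' hi'
    have := ha i' hi'
    rw [acc] at this ⊢
    rw [State.setReal_real, State.setReal_real, State.setReal_real]
    rcases Nat.lt_trichotomy i' i with hh | hh | hh
    · rw [if_neg (by omega), if_neg (by omega), this, if_pos hh, if_pos (by omega)]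
    · subst hh; simp
    · rw [if_neg (by omega), if_neg (by omega), this, if_neg (by omega), if_neg (by omega)]

end IPE

namespace IPE

open RealRAM

variable {π : Params} {X : ℕ → ℕ → ℝ} {s : State} {S : ℕ} {q : ℕ → ℝ}

/-- The memory between calls. -/
structure Stored (π : Params) (X : ℕ → ℕ → ℝ) (μ : Memory) : Prop where
  core : Core π X μ
  acc : ∀ i < π.n, acc π μ i = 0

/-- Draw samples, then output the estimates. -/
def queryCmd : Cmd := .seq (forLoop 7 4 sampleCmd) (forLoop 8 2 outputBody)

open Classical in
/-- Indicator of a wrong answer. -/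
noncomputable def wrong (n : ℕ) (ip : ℕ → ℝ) (ε : ℝ) (s : State) : ℝ≥0∞ :=
  if ∀ i < n, ip i - ε ≤ s.out i ∧ s.out i ≤ ip i + ε then 0 else 1

/-- The number of samples suffices for accuracy `ε` with probability `1 - δ`. -/
structure Params.Accurate (π : Params) (D ε δ : ℝ) : Prop where
  D_pos : 0 < D
  ε_pos : 0 < ε
  δ_pos : 0 < δ
  m_pos : 0 < π.m
  M_eq : π.M = 8 * D ^ 2 / ε
  m_eq : ∃ K r : ℕ, 16 * D ^ 2 / ε ^ 2 ≤ K ∧ 2 * π.n ≤ δ * 2 ^ r ∧ π.m = K * r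

lemma Params.Accurate.M_pos {D ε δ : ℝ} (h : π.Accurate D ε δ) : 0 < π.M := by
  have := h.D_pos; have := h.ε_pos
  rw [h.M_eq]; positivity

/-- The weight `W k` is the potential after `k` samples, normalized to start at most at `δ`. It does
not grow in expectation and finally dominates the indicator `wrong`. Outputting also clears the
accumulators, so the next query starts afresh. -/
lemma queryCmd_spec {D ε δ : ℝ} (hπ : π.Fit S) (hacc : π.Accurate D ε δ)
    (hq : ∑ i ∈ Finset.range π.d, q i ^ 2 ≤ 1)
    (hX : ∀ i < π.n, ∑ j ∈ Finset.range π.d, X i j ^ 2 ≤ D ^ 2)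
    (hs : s.mem.Fits S) (h : Stored π X s.mem) (hin : s.realIn = q) :
    Tri S (π.m * (13 * π.b + 42 * π.d + 7 * 2 ^ π.b + 35 * π.n + 27) + 28 * π.n + 7) queryCmd s
      (ENNReal.ofReal δ) (fun s => Stored π X s.mem)
      (wrong π.n (fun i => ∑ j ∈ Finset.range π.d, q j * X i j) ε) := by
  have hS := hπ.size
  have hp := Nat.two_pow_pos π.b
  set ip : ℕ → ℝ := fun i => ∑ j ∈ Finset.range π.d, q j * X i j with hip
  have hδ := hacc.δ_pos
  set c : ℝ := δ / (2 * π.n) with hc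
  have hc0 : 0 ≤ c := by positivity
  let W : ℕ → State → ℝ≥0∞ := fun k s => ENNReal.ofReal (c * pot π.n π.M D ip k (acc π s.mem))
  refine Tri.seq (T₁ := π.m * (13 * π.b + 42 * π.d + 7 * 2 ^ π.b + 35 * π.n + 27) + 3)
    (T₂ := 28 * π.n + 3) (Q := fun s => Core π X s.mem ∧ s.realIn = q) (g := W π.m) hs
    (Tri.forLoop π.m (fun _ => 13 * π.b + 42 * π.d + 7 * 2 ^ π.b + 35 * π.n + 21)
      (fun _ s => Core π X s.mem ∧ s.realIn = q) W hs (by omega) (by omega) (by omega) (by omega)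
      (by omega) h.core.m ⟨h.core, hin⟩ ?_ ?_ ?_ ?_ ?_) ?_ (by omega)
  · simp only [W]
    refine ENNReal.ofReal_le_ofReal ?_
    rw [pot_zero _ _ _ _ h.acc, hc]
    -- For no points the division by zero makes `c` zero and the bound trivial.
    rcases Nat.eq_zero_or_pos π.n with h0 | h0
    · rw [h0]; simp [hδ.le]
    · have : (0 : ℝ) < π.n := by exact_mod_cast h0
      exact le_of_eq (by field_simp)
  · intro k s a x ha h
    exact ⟨h.1.setInt (by omega), h.2⟩
  · intro k s a x ha
    rfl
  · intro k hk s hs h h7 h4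
    refine (sampleCmd_spec (k := k) (A := acc π s.mem) hπ hq hs ⟨h.1, h.2, h7, rfl⟩
      (fun u => ENNReal.ofReal (c * pot π.n π.M D ip (k + 1)
        (fun i => acc π s.mem i + contrib (2 ^ π.b) π.M q (X i) π.d u))) ?_ ?_).mono le_rfl le_rfl
      ?_ (fun _ _ => le_rfl)
    · have hsum := sum_pot_le hacc.M_pos hπ.two_d hq hX k (acc π s.mem)
      rw [← hip] at hsum
      simp only [avg, zero_mul, zero_add, W]
      rw [← ENNReal.ofReal_sum_of_nonneg fun u _ => mul_nonneg hc0 (pot_nonneg _ _ _ _ _ _),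
        ← Finset.mul_sum]
      calc _ ≤ ((2 : ℝ≥0∞) ^ π.b)⁻¹ * ENNReal.ofReal ((2 ^ π.b : ℕ) *
            (c * pot π.n π.M D ip k (acc π s.mem))) := by
            refine mul_le_mul_right (ENNReal.ofReal_le_ofReal ?_) _
            calc _ ≤ c * ((2 ^ π.b : ℕ) * pot π.n π.M D ip k (acc π s.mem)) :=
                  mul_le_mul_of_nonneg_left hsum hc0
              _ = _ := by ring
        _ = _ := by
            rw [ENNReal.ofReal_mul (by positivity), ← mul_assoc, ENNReal.ofReal_natCast]
            push_cast
            rw [ENNReal.inv_mul_cancel (by simp) (by simp), one_mul]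
    · intro s' u hu h'
      simp only [W]
      rw [pot_congr h']
    · rintro s' ⟨h1, h2, h3⟩
      exact ⟨⟨h1, h2⟩, h3, h1.m⟩
  · simp; ring_nf; omega
  rintro s hs ⟨h, -⟩
  refine (Det.tri (v := W π.m s) (g := wrong π.n ip ε) (Det.forLoop π.n (fun _ => 22)
    (OutInv π X (acc π s.mem)) hs (by omega) (by omega) (by omega) (by omega) (by omega) h.n
    ⟨h, by simp, by simp⟩ ?_ ?_ (T := 28 * π.n + 3) ?_) ?_).mono le_rfl le_rfl ?_ fun _ _ => le_rfl
  · intro i s a x ha h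
    exact h.setInt (by omega)
  · intro i hi s hs h h8 _
    exact outputBody_spec hπ hs h hi h8
  · simp; omega
  · intro s' h'
    unfold wrong
    split_ifs with hw
    · exact zero_le
    · push Not at hw
      obtain ⟨i, hi, hw⟩ := hw
      obtain ⟨K, r, hK, hr, hm⟩ := hacc.m_eq
      have := one_le_pot (n := π.n) (A := acc π s.mem) (ip := ip) hacc.D_pos hacc.ε_pos hδ hK hm hr
        hacc.m_pos hi (by rw [← h'.out i hi]; exact fun h => absurd h.2 (not_le.2 (hw h.1)))
      simp only [W]
      rw [← ENNReal.ofReal_one, hacc.M_eq]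
      exact ENNReal.ofReal_le_ofReal this
  · intro s' h'
    exact ⟨h'.core, fun i hi => by rw [h'.acc i hi, if_pos hi]⟩

/-! ### Updates -/

/-- Overwrite the point with the given index. -/
def updateCmd : Cmd :=
  .seq (block [.intConst 7 0, .readInt 8 7, .intMul 8 8 3, .intConst 9 16, .intAdd 8 9 8])
    (forLoop 7 3 (block [.readReal 3 7, .intAdd 9 8 7, .realStore 9 3]))

lemma Core.setPt {Y : ℕ → ℕ → ℝ} (h : Core π X s.mem) {i j : ℕ} {y : ℝ}
    (hj : j < π.d) (hY : ∀ i' < π.n, ∀ j' < π.d, Y i' j' = if i' = i ∧ j' = j then y else X i' j') :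
    Core π Y (s.setReal (16 + (i * π.d + j)) y).mem where
  n := h.n
  d := h.d
  m := h.m
  b := h.b
  N := h.N
  H := by rw [State.setReal_real, if_neg (by omega), h.H]
  M := by rw [State.setReal_real, if_neg (by omega), h.M]
  negM := by rw [State.setReal_real, if_neg (by omega), h.negM]
  pts i' hi' j' hj' := by
    rw [State.setReal_real, hY i' hi' j' hj', h.pts i' hi' j' hj']
    refine if_congr ⟨fun e => index_inj hj' hj (by omega), fun e => by rw [e.1, e.2]⟩ rfl rfl

lemma updateCmd_spec {i : ℕ} {z : ℕ → ℝ} (hπ : π.Fit S) (hs : s.mem.Fits S)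
    (h : Stored π X s.mem) (hi : i < π.n) (hint : s.intIn 0 = i) (hin : s.realIn = z) :
    Det S (12 * π.d + 14) updateCmd s
      (fun s => Stored π (fun i' j => if i' = i then z j else X i' j) s.mem) := by
  have hS := hπ.size
  have hp := Nat.two_pow_pos π.b
  have hd := hπ.d_pos
  have hidx := index_lt hi hd
  have hnd : π.n ≤ π.n * π.d := Nat.le_mul_of_pos_right _ hd
  -- The points when the first `j` coordinates of row `i` have been overwritten.
  let Y : ℕ → ℕ → ℕ → ℝ := fun j i' j' => if i' = i ∧ j' < j then z j' else X i' j'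
  refine Det.seq (T₁ := 10) (T₂ := 12 * π.d + 3) (Q := fun s => (Core π X s.mem ∧
    ∀ i' < π.n, acc π s.mem i' = 0) ∧ s.realIn = z ∧
    s.mem.int 8 = 16 + i * π.d) hs (Det.of_block (by simp) hs ?_ (by simp)) ?_ (by omega)
  · simp only [blockWP, Instr.Ok, Instr.exec]
    refine ⟨⟨by omega, by omega⟩, ⟨by omega, ?_⟩, ⟨by omega, ?_⟩, ⟨by omega, by omega⟩,
      ⟨by omega, ?_⟩, ⟨.setInt (.setInt (.setInt (.setInt (.setInt h.core ?_) ?_) ?_) ?_) ?_,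
      h.acc⟩, hin, ?_⟩
    · simp [hint]; omega
    · simp [hint, h.core.d]; omega
    · simp [hint, h.core.d]; omega
    any_goals omega
    simp [hint, h.core.d]
  rintro s hs ⟨⟨hcore, hacc⟩, hin, h8⟩
  refine (Det.forLoop (S := S) π.d (fun _ => 6) (fun j s => Core π (Y j) s.mem ∧
    (∀ i' < π.n, acc π s.mem i' = 0) ∧ s.realIn = z ∧ s.mem.int 8 = 16 + i * π.d) hs (by omega)
    (by omega) (by omega) (by omega) (by omega) hcore.d ⟨by simpa [Y] using hcore, hacc, hin, h8⟩
    ?_ ?_ le_rfl).mono ?_ ?_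
  · rintro j s a x ha ⟨h1, h2, h3, h4⟩
    exact ⟨h1.setInt (by omega), h2, h3, by rw [State.setInt_int, if_neg (by omega), h4]⟩
  · rintro j hj s hs ⟨h1, h2, h3, h4⟩ h7 h3d
    have hij := index_lt hi hj
    refine Det.of_block (by simp) hs ?_ (by simp)
    simp only [blockWP, Instr.Ok, Instr.exec]
    refine ⟨by omega, ⟨by omega, ?_⟩, ?_, ⟨?_, ?_, ?_, ?_⟩, ?_, ?_⟩
    · simp [h4, h7]; omega
    · simp [h4, h7]; omega
    · simp only [State.setInt_int, State.setReal_int, State.setInt_real, State.setReal_real, h4, h7,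
        h3, if_true, add_assoc]
      refine Core.setPt (X := Y j) ((h1.setReal (by omega)).setInt (by omega)) hj ?_
      intro i' hi' j' hj'
      simp only [Y]
      by_cases e : i' = i
      · rcases Nat.lt_trichotomy j' j with hh | hh | hh
        · rw [if_pos ⟨e, by omega⟩, if_neg (by omega), if_pos ⟨e, hh⟩]
        · rw [if_pos ⟨e, by omega⟩, if_pos ⟨e, hh⟩, hh]
        · rw [if_neg (by omega), if_neg (by omega), if_neg (by omega)]
      · rw [if_neg (by omega), if_neg (by omega), if_neg (by omega)]
    · intro i' hi'
      have := h2 i' hi'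
      rw [acc] at this ⊢
      simp only [State.setInt_int, State.setReal_int, State.setInt_real, State.setReal_real, h4, h7,
        if_true]
      rw [if_neg (by omega), if_neg (by omega), this]
    · simp [h3]
    · simp [h4]
    · simp [h7]
    · simp [h3d]
  · simp; omega
  · rintro s ⟨h1, h2, -, -⟩
    exact ⟨⟨h1.n, h1.d, h1.m, h1.b, h1.N, h1.H, h1.M, h1.negM, fun i' hi' j hj => by
      rw [h1.pts i' hi' j hj]; simp [Y, hj]⟩, h2⟩

/-! ### Initialization -/

/-- Compute the parameters and copy the points. -/
def initCmd : Cmd :=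
  .seq (block [.intConst 7 0, .readInt 2 7, .readReal 3 7, .intConst 7 1, .readInt 3 7,
      .readReal 4 7, .intConst 7 2, .readReal 5 7, .realMul 6 3 3, .realConst 7 8, .realMul 1 7 6,
      .realDiv 1 1 4, .realConst 7 0, .realSub 2 7 1, .realConst 7 16, .realMul 6 7 6,
      .realMul 4 4 4, .realDiv 6 6 4, .intConst 8 0, .realConst 7 0])
    (.seq (.loop (.realLt 7 6) (block [.intConst 1 1, .intAdd 8 8 1, .realOfInt 7 8]))
      (.seq (block [.intConst 9 0, .intAdd 10 2 2, .realOfInt 6 10])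
        (.seq (.loop (.realLt 5 6) (block [.realAdd 5 5 5, .intConst 1 1, .intAdd 9 9 1]))
          (.seq (block [.intMul 4 8 9, .intConst 5 0, .intConst 6 1, .intAdd 10 3 3])
            (.seq (.loop (.intLt 6 10) (block [.intAdd 6 6 6, .intConst 1 1, .intAdd 5 5 1]))
              (.seq (block [.realOfInt 0 6, .realConst 7 2, .realDiv 0 0 7, .intMul 10 2 3])
                (forLoop 7 10 (block [.intConst 11 3, .intAdd 11 11 7, .readReal 6 11,
                  .intConst 12 16, .intAdd 12 12 7, .realStore 12 6]))))))))

/-- State while the parameters are being computed. -/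
structure InitBase (π : Params) (rin : ℕ → ℝ) (s : State) : Prop where
  rin_eq : s.realIn = rin
  n : s.mem.int 2 = π.n
  d : s.mem.int 3 = π.d
  M : s.mem.real 1 = π.M
  negM : s.mem.real 2 = -π.M
  zero : ∀ a, 16 ≤ a → s.mem.real a = 0

lemma InitBase.setInt {rin : ℕ → ℝ} (h : InitBase π rin s) {a x : ℕ} (ha : a < 2 ∨ 3 < a) :
    InitBase π rin (s.setInt a x) where
  rin_eq := h.rin_eq
  n := by rw [State.setInt_int, if_neg (by omega), h.n]
  d := by rw [State.setInt_int, if_neg (by omega), h.d]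
  M := h.M
  negM := h.negM
  zero := h.zero

lemma InitBase.setReal {rin : ℕ → ℝ} (h : InitBase π rin s) {a : ℕ} {x : ℝ}
    (ha : a < 1 ∨ 2 < a ∧ a < 16) : InitBase π rin (s.setReal a x) where
  rin_eq := h.rin_eq
  n := h.n
  d := h.d
  M := by rw [State.setReal_real, if_neg (by omega), h.M]
  negM := by rw [State.setReal_real, if_neg (by omega), h.negM]
  zero b hb := by rw [State.setReal_real, if_neg (by omega), h.zero b hb]

/-- State after the first `a` coordinates have been copied. -/
structure CopyInv (π : Params) (rin : ℕ → ℝ) (a : ℕ) (s : State) : Prop where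
  rin_eq : s.realIn = rin
  n : s.mem.int 2 = π.n
  d : s.mem.int 3 = π.d
  m : s.mem.int 4 = π.m
  b : s.mem.int 5 = π.b
  N : s.mem.int 6 = 2 ^ π.b
  H : s.mem.real 0 = ((2 ^ π.b : ℕ) : ℝ) / 2
  M : s.mem.real 1 = π.M
  negM : s.mem.real 2 = -π.M
  cells : ∀ c, s.mem.real (16 + c) = if c < a then rin (3 + c) else 0

lemma CopyInv.setInt {rin : ℕ → ℝ} {c : ℕ} (h : CopyInv π rin c s) {a x : ℕ} (ha : a < 2 ∨ 6 < a) :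
    CopyInv π rin c (s.setInt a x) where
  rin_eq := h.rin_eq
  n := by rw [State.setInt_int, if_neg (by omega), h.n]
  d := by rw [State.setInt_int, if_neg (by omega), h.d]
  m := by rw [State.setInt_int, if_neg (by omega), h.m]
  b := by rw [State.setInt_int, if_neg (by omega), h.b]
  N := by rw [State.setInt_int, if_neg (by omega), h.N]
  H := h.H
  M := h.M
  negM := h.negM
  cells := h.cells

lemma CopyInv.setReal {rin : ℕ → ℝ} {c : ℕ} (h : CopyInv π rin c s) {a : ℕ} {x : ℝ}
    (ha : 2 < a ∧ a < 16) : CopyInv π rin c (s.setReal a x) where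
  rin_eq := h.rin_eq
  n := h.n
  d := h.d
  m := h.m
  b := h.b
  N := h.N
  H := by rw [State.setReal_real, if_neg (by omega), h.H]
  M := by rw [State.setReal_real, if_neg (by omega), h.M]
  negM := by rw [State.setReal_real, if_neg (by omega), h.negM]
  cells b := by rw [State.setReal_real, if_neg (by omega), h.cells b]

lemma CopyInv.store {rin : ℕ → ℝ} {c : ℕ} (h : CopyInv π rin c s) :
    CopyInv π rin (c + 1) (s.setReal (16 + c) (rin (3 + c))) where
  rin_eq := h.rin_eq
  n := h.n
  d := h.d
  m := h.m
  b := h.b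
  N := h.N
  H := by rw [State.setReal_real, if_neg (by omega), h.H]
  M := by rw [State.setReal_real, if_neg (by omega), h.M]
  negM := by rw [State.setReal_real, if_neg (by omega), h.negM]
  cells b := by
    rw [State.setReal_real]
    rcases Nat.lt_trichotomy b c with hh | hh | hh
    · rw [if_neg (by omega), h.cells b, if_pos hh, if_pos (by omega)]
    · subst hh; simp
    · rw [if_neg (by omega), h.cells b, if_neg (by omega), if_neg (by omega)]

lemma CopyInv.stored {rin : ℕ → ℝ} (h : CopyInv π rin (π.n * π.d) s)
    (hX : ∀ i < π.n, ∀ j < π.d, rin (3 + (i * π.d + j)) = X i j) : Stored π X s.mem where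
  core := ⟨h.n, h.d, h.m, h.b, h.N, h.H, h.M, h.negM, fun i hi j hj => by
    rw [h.cells, if_pos (index_lt hi hj), hX i hi j hj]⟩
  acc i hi := by
    rw [acc, add_assoc, h.cells, if_neg (by omega)]

/-- `hK`, `hr` and `hb` describe `K`, `r` and `π.b` by the very comparisons that end the three
search loops: counting up to `16 * D ^ 2 / ε ^ 2`, doubling `δ` up to `2 * n`, doubling 1 up to `2 *
d`. Neither ceilings nor logarithms are computed. -/
lemma initCmd_spec {rin : ℕ → ℝ} {D ε δ : ℝ} {K r : ℕ} (hπ : π.Fit S) (hM : π.M = 8 * D ^ 2 / ε)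
    (hK : ∀ k : ℕ, (k : ℝ) < 16 * D ^ 2 / ε ^ 2 ↔ k < K)
    (hr : ∀ k : ℕ, δ * 2 ^ k < 2 * π.n ↔ k < r) (hb : ∀ k : ℕ, 2 ^ k < 2 * π.d ↔ k < π.b)
    (hm : π.m = K * r) (hK0 : 0 < K) (hr0 : 0 < r) (hs : s.mem.Fits S)
    (h0 : ∀ a, s.mem.real a = 0) (hn : s.intIn 0 = π.n) (hd : s.intIn 1 = π.d) (hin : s.realIn = rin)
    (hD : rin 0 = D) (hε : rin 1 = ε) (hδ : rin 2 = δ)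
    (hX : ∀ i < π.n, ∀ j < π.d, rin (3 + (i * π.d + j)) = X i j) :
    Det S (18 * (π.n * π.d) + 7 * K + 7 * r + 7 * π.b + 80) initCmd s
      (fun s => Stored π X s.mem) := by
  have hS := hπ.size
  have hp := Nat.two_pow_pos π.b
  have hd0 := hπ.d_pos
  have hd2 := hπ.two_d
  have hnd : π.n ≤ π.n * π.d := Nat.le_mul_of_pos_right _ hd0
  -- Since both factors of `π.m` are positive, the search counters are at most `π.m` and fit into a
  -- word.
  have hKm : K ≤ π.m := hm ▸ Nat.le_mul_of_pos_right _ hr0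
  have hrm : r ≤ π.m := hm ▸ Nat.le_mul_of_pos_left _ hK0
  refine Det.seq (T₁ := 40) (T₂ := 18 * (π.n * π.d) + 7 * K + 7 * r + 7 * π.b + 39)
    (Q := fun s => InitBase π rin s ∧ s.mem.real 5 = δ ∧ s.mem.real 6 = 16 * D ^ 2 / ε ^ 2 ∧
      s.mem.int 8 = 0 ∧ s.mem.real 7 = 0) hs (Det.of_block (by simp) hs ?_ (by simp)) ?_ (by omega)
  · simp only [blockWP, Instr.Ok, Instr.exec]
    refine ⟨⟨by omega, by omega⟩, ⟨by omega, ?_⟩, by omega, ⟨by omega, by omega⟩, ⟨by omega, ?_⟩,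
      by omega, ⟨by omega, by omega⟩, by omega, by omega, by omega, by omega, by omega, by omega,
      by omega, by omega, by omega, by omega, by omega, ⟨by omega, by omega⟩, by omega,
      ⟨?_, ?_, ?_, ?_, ?_, ?_⟩, ?_, ?_, ?_, ?_⟩
    · simp [hn]; omega
    · simp [hd]; omega
    · simp [hin]
    · simp [hn]
    · simp [hd]
    · simp [hin, hD, hε, hM, pow_two]
    · simp [hin, hD, hε, hM, pow_two]
    · intro a ha
      simp only [State.setReal_real, State.setInt_real]
      -- The block makes 14 writes to real cells, all below 16.
      iterate 14 rw [if_neg (by omega)]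
      exact h0 a
    · simp [hin, hδ]
    · simp [hin, hD, hε, pow_two]
    · simp
    · simp
  intro s hs h
  refine Det.seq (T₁ := 7 * K + 1) (T₂ := 18 * (π.n * π.d) + 7 * r + 7 * π.b + 37)
    (Q := fun s => InitBase π rin s ∧ s.mem.real 5 = δ ∧ s.mem.int 8 = K) hs
    ((Det.loop K 6 (fun k s => InitBase π rin s ∧ s.mem.real 5 = δ ∧
      s.mem.real 6 = 16 * D ^ 2 / ε ^ 2 ∧ s.mem.int 8 = k ∧ s.mem.real 7 = k) hs
      (by simpa using h) ?_ ?_ ?_ le_rfl).mono (by omega) ?_) ?_ (by omega)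
  · rintro k hk s ⟨-, -, h6, -, h7⟩
    simp only [Test.holds, h6, h7]; exact (hK k).2 hk
  · rintro s ⟨-, -, h6, -, h7⟩
    simp only [Test.holds, h6, h7]
    exact fun h => lt_irrefl _ ((hK K).1 h)
  · rintro k hk s hs ⟨h, h5, h6, h8, h7⟩
    refine Det.of_block (by simp) hs ?_ (by simp)
    simp only [blockWP, Instr.Ok, Instr.exec]
    refine ⟨⟨by omega, by omega⟩, ⟨by omega, ?_⟩, by omega, ((h.setInt ?_).setInt ?_).setReal ?_, ?_⟩
    · simp [h8]; omega
    any_goals omega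
    simp [h5, h6, h8]
  · rintro s ⟨h, h5, h6, h8, h7⟩
    exact ⟨h, h5, h8⟩
  rintro s hs ⟨h, h5, h8⟩
  refine Det.seq (T₁ := 6) (T₂ := 18 * (π.n * π.d) + 7 * r + 7 * π.b + 30)
    (Q := fun s => InitBase π rin s ∧ s.mem.int 8 = K ∧ s.mem.real 5 = δ ∧
      s.mem.real 6 = 2 * π.n ∧ s.mem.int 9 = 0) hs (Det.of_block (by simp) hs ?_ (by simp)) ?_
      (by omega)
  · simp only [blockWP, Instr.Ok, Instr.exec]
    refine ⟨⟨by omega, by omega⟩, ⟨by omega, ?_⟩, by omega, ((h.setInt ?_).setInt ?_).setReal ?_, ?_⟩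
    · simp [h.n]; omega
    any_goals omega
    simp [h8, h5, h.n, two_mul]
  intro s hs h
  refine Det.seq (T₁ := 7 * r + 1) (T₂ := 18 * (π.n * π.d) + 7 * π.b + 28)
    (Q := fun s => InitBase π rin s ∧ s.mem.int 8 = K ∧ s.mem.int 9 = r) hs
    ((Det.loop r 6 (fun k s => InitBase π rin s ∧ s.mem.int 8 = K ∧ s.mem.real 5 = δ * 2 ^ k ∧
      s.mem.real 6 = 2 * π.n ∧ s.mem.int 9 = k) hs
      (by simpa using h) ?_ ?_ ?_ le_rfl).mono (by omega) ?_) ?_ (by omega)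
  · rintro k hk s ⟨-, -, h5, h6, -⟩
    simp only [Test.holds, h5, h6]; exact (hr k).2 hk
  · rintro s ⟨-, -, h5, h6, -⟩
    simp only [Test.holds, h5, h6]
    exact fun h => lt_irrefl _ ((hr r).1 h)
  · rintro k hk s hs ⟨h, h8, h5, h6, h9⟩
    refine Det.of_block (by simp) hs ?_ (by simp)
    simp only [blockWP, Instr.Ok, Instr.exec]
    refine ⟨by omega, ⟨by omega, by omega⟩, ⟨by omega, ?_⟩, ((h.setReal ?_).setInt ?_).setInt ?_, ?_⟩
    · simp [h9]; omega
    any_goals omega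
    simp [h5, h6, h8, h9, pow_succ, mul_two, mul_add]
  · rintro s ⟨h, h8, -, -, h9⟩
    exact ⟨h, h8, h9⟩
  rintro s hs ⟨h, h8, h9⟩
  refine Det.seq (T₁ := 8) (T₂ := 18 * (π.n * π.d) + 7 * π.b + 19)
    (Q := fun s => InitBase π rin s ∧ s.mem.int 4 = π.m ∧ s.mem.int 5 = 0 ∧
      s.mem.int 6 = 1 ∧ s.mem.int 10 = 2 * π.d) hs (Det.of_block (by simp) hs ?_ (by simp)) ?_
      (by omega)
  · simp only [blockWP, Instr.Ok, Instr.exec]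
    refine ⟨⟨by omega, ?_⟩, ⟨by omega, by omega⟩, ⟨by omega, by omega⟩, ⟨by omega, ?_⟩,
      (((h.setInt ?_).setInt ?_).setInt ?_).setInt ?_, ?_⟩
    · rw [h8, h9, ← hm]; omega
    · simp [h.d]; omega
    any_goals omega
    simp [h8, h9, h.d, two_mul, hm]
  intro s hs h
  refine Det.seq (T₁ := 7 * π.b + 1) (T₂ := 18 * (π.n * π.d) + 17)
    (Q := fun s => InitBase π rin s ∧ s.mem.int 4 = π.m ∧ s.mem.int 5 = π.b ∧
      s.mem.int 6 = 2 ^ π.b) hs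
    ((Det.loop π.b 6 (fun k s => InitBase π rin s ∧ s.mem.int 4 = π.m ∧ s.mem.int 5 = k ∧
      s.mem.int 6 = 2 ^ k ∧ s.mem.int 10 = 2 * π.d) hs
      (by simpa using h) ?_ ?_ ?_ le_rfl).mono (by omega) ?_) ?_ (by omega)
  · rintro k hk s ⟨-, -, -, h6, h10⟩
    simp only [Test.holds, h6, h10]; exact (hb k).2 hk
  · rintro s ⟨-, -, -, h6, h10⟩
    simp only [Test.holds, h6, h10]
    exact fun h => lt_irrefl _ ((hb _).1 h)
  · rintro k hk s hs ⟨h, h4, h5, h6, h10⟩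
    have hpow : 2 ^ (k + 1) ≤ 2 ^ π.b := Nat.pow_le_pow_right (by norm_num) hk
    rw [pow_succ] at hpow
    refine Det.of_block (by simp) hs ?_ (by simp)
    simp only [blockWP, Instr.Ok, Instr.exec]
    refine ⟨⟨by omega, by omega⟩, ⟨by omega, by omega⟩, ⟨by omega, ?_⟩,
      ((h.setInt ?_).setInt ?_).setInt ?_, ?_⟩
    · simp [h5]; omega
    any_goals omega
    simp [h4, h5, h6, h10, pow_succ, mul_two]
  · rintro s ⟨h, h4, h5, h6, -⟩
    exact ⟨h, h4, h5, h6⟩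
  rintro s hs ⟨h, h4, h5, h6⟩
  refine Det.seq (T₁ := 8) (T₂ := 18 * (π.n * π.d) + 3)
    (Q := fun s => CopyInv π rin 0 s ∧ s.mem.int 10 = π.n * π.d) hs
    (Det.of_block (by simp) hs ?_ (by simp)) ?_ (by omega)
  · simp only [blockWP, Instr.Ok, Instr.exec]
    refine ⟨by omega, by omega, by omega, ⟨by omega, ?_⟩, ⟨?_, ?_, ?_, ?_, ?_, ?_, ?_, ?_, ?_, ?_⟩,
      ?_⟩
    · simp [h.n, h.d]; omega
    · simp [h.rin_eq]
    · simp [h.n]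
    · simp [h.d]
    · simp [h4]
    · simp [h5]
    · simp [h6]
    · simp [h6]
    · simp [h.M]
    · simp [h.negM]
    · intro c
      simp only [State.setReal_real, State.setInt_real]
      rw [if_neg (by omega), if_neg (by omega), if_neg (by omega), if_neg (by omega)]
      exact h.zero _ (by omega)
    · simp [h.n, h.d]
  rintro s hs ⟨h, h10⟩
  refine (Det.forLoop (S := S) (π.n * π.d) (fun _ => 12) (CopyInv π rin) hs (by omega) (by omega)
    (by omega) (by omega) (by omega) h10 h ?_ ?_ le_rfl).mono ?_ fun s h => h.stored hX
  · intro k s a x ha h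
    exact h.setInt (by omega)
  · intro c hc s hs h h7 h10
    refine Det.of_block (by simp) hs ?_ (by simp)
    simp only [blockWP, Instr.Ok, Instr.exec]
    refine ⟨⟨by omega, by omega⟩, ⟨by omega, ?_⟩, by omega, ⟨by omega, by omega⟩, ⟨by omega, ?_⟩,
      ?_, ?_, ?_, ?_⟩
    · simp [h7]; omega
    · simp [h7]; omega
    · simp [h7]; omega
    · have := CopyInv.store (((((h.setInt (a := 11) (x := 3) (by omega)).setInt (a := 11)
        (x := 3 + c) (by omega)).setReal (a := 6) (x := rin (3 + c)) (by omega)).setInt (a := 12)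
        (x := 16) (by omega)).setInt (a := 12) (x := 16 + c) (by omega))
      simpa [h7, h.rin_eq] using this
    · simp [h7]
    · simp [h10]
  · simp; omega

end IPE

namespace IPE

open RealRAM

/-! ### The data structure -/

/-- The data structure: `ℓ²`-sampling of coordinates with fresh randomness for every query. -/
def samplingStructure : DataStructure := ⟨initCmd, updateCmd, queryCmd⟩

/-- The parameters for given size, accuracy and confidence. -/
noncomputable def params (n d : ℕ) (D ε δ : ℝ) : Params where
  n := n
  d := d
  m := ⌈16 * D ^ 2 / ε ^ 2⌉₊ * ⌈Real.logb 2 (2 * n / δ)⌉₊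
  b := Nat.clog 2 (2 * d)
  M := 8 * D ^ 2 / ε

/-- The space used. -/
noncomputable def space (π : Params) : ℕ := π.n * π.d + π.n + π.m + π.b + 2 ^ π.b + 64

/-- The points as a zero-padded array. -/
noncomputable def pts {n d : ℕ} (x : Fin n → Pt d) (i j : ℕ) : ℝ :=
  if h : i < n then vecIn (x ⟨i, h⟩) j else 0

lemma vecIn_fin {d : ℕ} (v : Pt d) (j : Fin d) : vecIn v j = v j := by simp [vecIn]

lemma pts_fin {n d : ℕ} (x : Fin n → Pt d) (i : Fin n) : pts x i = vecIn (x i) := by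
  funext j; simp [pts]

lemma sum_vecIn_sq {d : ℕ} (v : Pt d) : ∑ j ∈ Finset.range d, vecIn v j ^ 2 = ‖v‖ ^ 2 := by
  rw [Finset.sum_range, EuclideanSpace.real_norm_sq_eq]
  simp [vecIn_fin]

lemma sum_vecIn_mul {d : ℕ} (v w : Pt d) :
    ∑ j ∈ Finset.range d, vecIn v j * vecIn w j = inner ℝ v w := by
  rw [Finset.sum_range, PiLp.inner_apply]
  simp [vecIn_fin, mul_comm]

lemma sum_pts_sq_le {n d : ℕ} {x : Fin n → Pt d} {D : ℝ} (hx : ∀ i, ‖x i‖ ≤ D) :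
    ∀ i < n, ∑ j ∈ Finset.range d, pts x i j ^ 2 ≤ D ^ 2 := by
  intro i hi
  rw [show i = ((⟨i, hi⟩ : Fin n) : ℕ) from rfl, pts_fin, sum_vecIn_sq]
  exact pow_le_pow_left₀ (norm_nonneg _) (hx _) 2

lemma pts_update {n d : ℕ} (x : Fin n → Pt d) (i : Fin n) (z : Pt d) :
    (fun i' j => if i' = (i : ℕ) then vecIn z j else pts x i' j) = pts (Function.update x i z) := by
  funext i' j
  by_cases h : i' = i
  · subst h; simp [pts]
  · rw [if_neg h]
    unfold pts
    split_ifs with h'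
    · rw [Function.update_of_ne]
      exact fun e => h (congrArg Fin.val e)
    · rfl

lemma initRealIn_eq {n d : ℕ} (D ε δ : ℝ) (x : Fin n → Pt d) {i j : ℕ} (hi : i < n) (hj : j < d) :
    initRealIn D ε δ x (3 + (i * d + j)) = pts x i j := by
  rw [add_comm, initRealIn, dif_pos (index_lt hi hj)]
  have : finProdFinEquiv.symm ⟨i * d + j, index_lt hi hj⟩ = ((⟨i, hi⟩ : Fin n), (⟨j, hj⟩ : Fin d)) := by
    rw [Equiv.symm_apply_eq]
    ext
    simp [finProdFinEquiv, mul_comm, add_comm]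
  rw [this]
  simp [pts, vecIn, hi, hj]

/-! ### Explicit bounds for each call -/

section Fixed

variable {n d : ℕ} {D ε δ : ℝ}

/-- Time of the initialization. -/
noncomputable def initTime (n d : ℕ) (D ε δ : ℝ) : ℕ :=
  18 * (n * d) + 7 * ⌈16 * D ^ 2 / ε ^ 2⌉₊ + 7 * ⌈Real.logb 2 (2 * n / δ)⌉₊ +
    7 * Nat.clog 2 (2 * d) + 80

/-- Time of an update. -/
def updateTime (d : ℕ) : ℕ := 12 * d + 14

/-- Time of a query. -/
noncomputable def queryTime (n d : ℕ) (D ε δ : ℝ) : ℕ :=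
  (params n d D ε δ).m * (13 * Nat.clog 2 (2 * d) + 42 * d + 7 * 2 ^ Nat.clog 2 (2 * d) +
    35 * n + 27) + 28 * n + 7

lemma fit_params (hd : 1 ≤ d) : (params n d D ε δ).Fit (space (params n d D ε δ)) where
  d_pos := hd
  two_d := Nat.le_pow_clog (by norm_num) _
  size := le_rfl

/-- Identifies the stopping time of the doubling loop with the logarithm in `params`. -/
lemma lt_ceil_logb_iff (hn : 1 ≤ n) (hδ : 0 < δ) (k : ℕ) :
    δ * 2 ^ k < 2 * n ↔ k < ⌈Real.logb 2 (2 * n / δ)⌉₊ := by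
  have : (0 : ℝ) < n := by exact_mod_cast hn
  rw [Nat.lt_ceil, Real.lt_logb_iff_rpow_lt (by norm_num) (by positivity), Real.rpow_natCast,
    lt_div_iff₀ hδ, mul_comm]

lemma ceil_acc_pos (hD : 0 < D) (hε : 0 < ε) : 0 < ⌈16 * D ^ 2 / ε ^ 2⌉₊ :=
  Nat.ceil_pos.2 (by positivity)

lemma ceil_logb_pos (hn : 1 ≤ n) (hδ : 0 < δ) (hδ1 : δ < 1) :
    0 < ⌈Real.logb 2 (2 * n / δ)⌉₊ := by
  rw [← lt_ceil_logb_iff hn hδ]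
  have : (1 : ℝ) ≤ n := by exact_mod_cast hn
  rw [pow_zero]; linarith

lemma accurate_params (hn : 1 ≤ n) (hD : 0 < D) (hε : 0 < ε) (hδ : 0 < δ) (hδ1 : δ < 1) :
    (params n d D ε δ).Accurate D ε δ where
  D_pos := hD
  ε_pos := hε
  δ_pos := hδ
  m_pos := Nat.mul_pos (ceil_acc_pos hD hε) (ceil_logb_pos hn hδ hδ1)
  M_eq := rfl
  m_eq := ⟨_, _, Nat.le_ceil _,
    not_lt.1 fun h => lt_irrefl _ ((lt_ceil_logb_iff hn hδ _).1 h), rfl⟩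

/-- Memory between calls, with its size. -/
def Valid (D ε δ : ℝ) (x : Fin n → Pt d) (μ : Memory) : Prop :=
  Stored (params n d D ε δ) (pts x) μ ∧ μ.Fits (space (params n d D ε δ))

lemma init_safe (hn : 1 ≤ n) (hd : 1 ≤ d) (hD : 0 < D) (hε : 0 < ε) (hδ : 0 < δ) (hδ1 : δ < 1)
    (x : Fin n → Pt d) :
    Safe (space (params n d D ε δ)) (initTime n d D ε δ)
      (fun s => Stored (params n d D ε δ) (pts x) s.mem) (fun _ => 0)
      (samplingStructure.initCall D ε δ x) 0 := by
  have hfit : (params n d D ε δ).Fit (space (params n d D ε δ)) := fit_params hd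
  have hS := hfit.size
  refine Tri.safe (initCmd_spec (K := ⌈16 * D ^ 2 / ε ^ 2⌉₊) (r := ⌈Real.logb 2 (2 * n / δ)⌉₊) hfit
    rfl (fun k => Nat.lt_ceil.symm) (lt_ceil_logb_iff hn hδ)
    (fun k => (Nat.lt_clog_iff_pow_lt (by norm_num)).symm) rfl (ceil_acc_pos hD hε)
    (ceil_logb_pos hn hδ hδ1) ?_ (fun a => rfl) rfl rfl rfl rfl rfl rfl
    (fun i hi j hj => initRealIn_eq D ε δ x hi hj) 0)
  have hp := Nat.two_pow_pos (params n d D ε δ).b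
  have hp := Nat.two_pow_pos (params n d D ε δ).b
  intro a
  exact ⟨by simp only [Memory.blank]; omega, fun _ => ⟨rfl, rfl⟩⟩

lemma update_safe (hd : 1 ≤ d) {x : Fin n → Pt d} {μ : Memory} (h : Valid D ε δ x μ)
    (i : Fin n) (z : Pt d) :
    Safe (space (params n d D ε δ)) (updateTime d)
      (fun s => Stored (params n d D ε δ) (pts (Function.update x i z)) s.mem) (fun _ => 0)
      (samplingStructure.updateCall μ i z) 0 := by
  rw [← pts_update]
  exact Tri.safe (updateCmd_spec (fit_params hd) h.2 h.1 i.2 rfl rfl 0)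

/-- The failure bound holds for every valid memory, whatever its scratch cells contain; this
uniformity is what adaptive users cannot break. -/
lemma query_safe (hn : 1 ≤ n) (hd : 1 ≤ d) (hD : 0 < D) (hε : 0 < ε) (hδ : 0 < δ) (hδ1 : δ < 1)
    {x : Fin n → Pt d} {μ : Memory} (h : Valid D ε δ x μ) (hx : ∀ i, ‖x i‖ ≤ D) {q : Pt d}
    (hq : ‖q‖ ≤ 1) :
    Safe (space (params n d D ε δ)) (queryTime n d D ε δ)
      (fun s => Stored (params n d D ε δ) (pts x) s.mem)
      (wrong n (fun i => ∑ j ∈ Finset.range d, vecIn q j * pts x i j) ε)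
      (samplingStructure.queryCall μ q) (ENNReal.ofReal δ) := by
  refine Tri.safe (queryCmd_spec (π := params n d D ε δ) (fit_params hd)
    (accurate_params hn hD hε hδ hδ1) ?_ (sum_pts_sq_le hx) h.2 h.1 rfl)
  have := sum_vecIn_sq q
  show ∑ j ∈ Finset.range d, vecIn q j ^ 2 ≤ 1
  rw [this]
  exact pow_le_one₀ (norm_nonneg _) hq

lemma norm_update_le {x : Fin n → Pt d} (hx : ∀ i, ‖x i‖ ≤ D) {i : Fin n} {z : Pt d}
    (hz : ‖z‖ ≤ D) : ∀ j, ‖Function.update x i z j‖ ≤ D := by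
  intro j
  rw [Function.update_apply]
  split_ifs
  · exact hz
  · exact hx j

lemma Reachable.valid (hn : 1 ≤ n) (hd : 1 ≤ d) (hD : 0 < D) (hε : 0 < ε) (hδ : 0 < δ)
    (hδ1 : δ < 1) {μ : Memory} (h : Reachable samplingStructure n d D ε δ μ) :
    ∃ x : Fin n → Pt d, (∀ i, ‖x i‖ ≤ D) ∧ Valid D ε δ x μ := by
  induction h with
  | init x hx t c hc hh =>
    have := init_safe hn hd hD hε hδ hδ1 x
    exact ⟨x, hx, this.post t c hc hh, this.fits t c hc⟩
  | update m hm i z hz t c hc hh ih =>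
    obtain ⟨x, hx, hv⟩ := ih
    have := update_safe hd hv i z
    exact ⟨_, norm_update_le hx hz, this.post t c hc hh, this.fits t c hc⟩
  | query m hm q hq t c hc hh ih =>
    obtain ⟨x, hx, hv⟩ := ih
    have := query_safe hn hd hD hε hδ hδ1 hv hx hq
    exact ⟨x, hx, this.post t c hc hh, this.fits t c hc⟩

lemma worstCase (hn : 1 ≤ n) (hd : 1 ≤ d) (hD : 0 < D) (hε : 0 < ε) (hδ : 0 < δ) (hδ1 : δ < 1) :
    WorstCase samplingStructure n d D ε δ (initTime n d D ε δ) (updateTime d) (queryTime n d D ε δ)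
      (space (params n d D ε δ)) where
  init_time x _ := (init_safe hn hd hD hε hδ hδ1 x).halts _ le_rfl
  init_space x _ := (init_safe hn hd hD hε hδ hδ1 x).fits
  update_time m hm i z _ := by
    obtain ⟨x, -, hv⟩ := hm.valid hn hd hD hε hδ hδ1
    exact (update_safe hd hv i z).halts _ le_rfl
  update_space m hm i z _ := by
    obtain ⟨x, -, hv⟩ := hm.valid hn hd hD hε hδ hδ1
    exact (update_safe hd hv i z).fits
  query_time m hm q hq := by
    obtain ⟨x, hx, hv⟩ := hm.valid hn hd hD hε hδ hδ1
    exact (query_safe hn hd hD hε hδ hδ1 hv hx hq).halts _ le_rfl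
  query_space m hm q hq := by
    obtain ⟨x, hx, hv⟩ := hm.valid hn hd hD hε hδ hδ1
    exact (query_safe hn hd hD hε hδ hδ1 hv hx hq).fits

/-! ### Sessions with an adaptive user -/

lemma applyUpdates_norm_le (us : List (Fin n × Pt d)) {x : Fin n → Pt d} (hx : ∀ i, ‖x i‖ ≤ D)
    (hus : ∀ u ∈ us, ‖u.2‖ ≤ D) : ∀ i, ‖applyUpdates us x i‖ ≤ D := by
  induction us generalizing x with
  | nil => exact hx
  | cons u us ih =>
    exact ih (norm_update_le hx (hus u (by simp))) fun w hw => hus w (by simp [hw])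

lemma runUpdates_valid (hd : 1 ≤ d) (us : List (Fin n × Pt d)) {x : Fin n → Pt d} {μ μ' : Memory}
    (h : Valid D ε δ x μ)
    (hμ' : μ' ∈ (samplingStructure.runUpdates (updateTime d) us μ).support) :
    Valid D ε δ (applyUpdates us x) μ' := by
  induction us generalizing x μ with
  | nil =>
    rw [DataStructure.runUpdates, PMF.support_pure, Set.mem_singleton_iff] at hμ'
    subst hμ'; exact h
  | cons u us ih =>
    rw [DataStructure.runUpdates, PMF.mem_support_bind_iff] at hμ'
    obtain ⟨c, hc, hμ'⟩ := hμ'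
    have hs := update_safe hd h u.1 u.2
    exact ih ⟨hs.post _ c hc (hs.halts _ le_rfl c hc), hs.fits _ c hc⟩ hμ'

lemma play_valid (hn : 1 ≤ n) (hd : 1 ≤ d) (hD : 0 < D) (hε : 0 < ε) (hδ : 0 < δ) (hδ1 : δ < 1)
    {x : Fin n → Pt d} {A : Adversary n d} (hx : ∀ i, ‖x i‖ ≤ D) (hA : A.Valid D) (t : ℕ) :
    ∀ s ∈ (samplingStructure.play (initTime n d D ε δ) (updateTime d) (queryTime n d D ε δ)
      D ε δ x A t).support, (∀ i, ‖s.pts i‖ ≤ D) ∧ Valid D ε δ s.pts s.mem := by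
  induction t with
  | zero =>
    intro s hs
    rw [DataStructure.play, PMF.mem_support_map_iff] at hs
    obtain ⟨c, hc, rfl⟩ := hs
    have h := init_safe hn hd hD hε hδ hδ1 x
    exact ⟨hx, h.post _ c hc (h.halts _ le_rfl c hc), h.fits _ c hc⟩
  | succ t ih =>
    intro s' hs'
    rw [DataStructure.play, PMF.mem_support_bind_iff] at hs'
    obtain ⟨s, hs, hs'⟩ := hs'
    obtain ⟨hpts, hv⟩ := ih s hs
    rw [DataStructure.round, PMF.mem_support_bind_iff] at hs'
    obtain ⟨μ, hμ, hs'⟩ := hs'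
    rw [PMF.mem_support_map_iff] at hs'
    obtain ⟨c, hc, rfl⟩ := hs'
    have hpts' := applyUpdates_norm_le _ hpts (hA s.answers).1
    have h := query_safe hn hd hD hε hδ hδ1 (runUpdates_valid hd _ hv hμ) hpts' (hA s.answers).2
    exact ⟨hpts', h.post _ c hc (h.halts _ le_rfl c hc), h.fits _ c hc⟩

/-- A lower bound that holds conditionally on every possible past holds outright. -/
lemma le_toOuterMeasure_bind {α β : Type*} {p : PMF α} {f : α → PMF β} {B : Set β} {c : ℝ≥0∞}
    (h : ∀ a ∈ p.support, c ≤ (f a).toOuterMeasure B) : c ≤ (p.bind f).toOuterMeasure B := by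
  rw [PMF.toOuterMeasure_bind_apply]
  calc c = expect p fun _ => c := by simp [expect, ENNReal.tsum_mul_right, p.tsum_coe]
    _ ≤ _ := expect_mono p h

/-- Markov's inequality for the complement of `B`, written additively to avoid subtraction. -/
lemma one_le_toOuterMeasure_add_expect {α : Type*} (p : PMF α) {B : Set α} {F : α → ℝ≥0∞}
    (h : ∀ a ∉ B, 1 ≤ F a) : 1 ≤ p.toOuterMeasure B + expect p F := by
  rw [PMF.toOuterMeasure_apply, expect, ← ENNReal.tsum_add, ← p.tsum_coe]
  refine ENNReal.tsum_le_tsum fun a => ?_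
  by_cases ha : a ∈ B
  · simp [ha]
  · calc p a = p a * 1 := (mul_one _).symm
      _ ≤ p a * F a := mul_le_mul_right (h a ha) _
      _ ≤ _ := le_add_self

/-- Once the session before the round and the memory after its updates are fixed, the query point is
fixed too, and only the coins of this one query remain. So `query_safe` applies, with no union bound
over rounds. -/
lemma play_correct (hn : 1 ≤ n) (hd : 1 ≤ d) (hD : 0 < D) (hε : 0 < ε) (hδ : 0 < δ) (hδ1 : δ < 1)
    {x : Fin n → Pt d} {A : Adversary n d} (hx : ∀ i, ‖x i‖ ≤ D) (hA : A.Valid D) (t : ℕ) :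
    ENNReal.ofReal (1 - δ) ≤ (samplingStructure.play (initTime n d D ε δ) (updateTime d)
      (queryTime n d D ε δ) D ε δ x A (t + 1)).toOuterMeasure {s | s.LastCorrect A ε} := by
  rw [DataStructure.play]
  refine le_toOuterMeasure_bind fun s hs => ?_
  obtain ⟨hpts, hv⟩ := play_valid hn hd hD hε hδ hδ1 hx hA t s hs
  rw [DataStructure.round]
  refine le_toOuterMeasure_bind fun μ hμ => ?_
  have hpts' := applyUpdates_norm_le _ hpts (hA s.answers).1
  have h := query_safe hn hd hD hε hδ hδ1 (runUpdates_valid hd _ hv hμ) hpts' (hA s.answers).2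
  rw [PMF.toOuterMeasure_map_apply]
  have hle := one_le_toOuterMeasure_add_expect
    (runFor (queryTime n d D ε δ) (samplingStructure.queryCall μ (A s.answers).query))
    (B := (fun c : Config => ({ mem := c.st.mem
                                pts := applyUpdates (A s.answers).updates s.pts
                                answers := (fun i => c.st.out (i : ℕ)) :: s.answers } :
      Session n d)) ⁻¹' {s | s.LastCorrect A ε})
    (F := fun c => wrong n (fun i => ∑ j ∈ Finset.range d, vecIn (A s.answers).query j *
      pts (applyUpdates (A s.answers).updates s.pts) i j) ε c.st) ?_
  · rw [ENNReal.ofReal_sub _ hδ.le, ENNReal.ofReal_one]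
    exact tsub_le_iff_right.2 (hle.trans (add_le_add_right (h.val _ le_rfl) _))
  · intro c hc
    unfold wrong
    split_ifs with hw
    · refine absurd ?_ hc
      intro i
      have := hw i i.2
      simp only [pts_fin, sum_vecIn_mul] at this
      exact this
    · exact le_rfl

/-! ### Asymptotics -/

lemma one_le_accFactor : 1 ≤ accFactor D ε := le_max_left _ _

lemma one_le_confFactor : 1 ≤ confFactor δ := le_max_left _ _

lemma one_le_log {f : ℝ} (hf : 1 ≤ f) : 1 ≤ Real.log (2 + f) := by
  rw [Real.le_log_iff_exp_le (by linarith)]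
  have := Real.exp_one_lt_d9
  linarith

lemma samples_le (hn : 1 ≤ n) (hδ : 0 < δ) {f : ℝ} (hf : n ≤ f) :
    ((params n d D ε δ).m : ℝ) ≤ 102 * (accFactor D ε * confFactor δ * Real.log (2 + f)) := by
  have hn' : (1 : ℝ) ≤ n := by exact_mod_cast hn
  have hκ : 1 ≤ accFactor D ε := one_le_accFactor
  have hΛ : 1 ≤ confFactor δ := one_le_confFactor
  have hl := one_le_log (hn'.trans hf)
  set l := Real.log (2 + f)
  have h1 : (⌈16 * D ^ 2 / ε ^ 2⌉₊ : ℝ) ≤ 17 * accFactor D ε := by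
    have h := (Nat.ceil_lt_add_one (a := 16 * D ^ 2 / ε ^ 2) (by positivity)).le
    have h' : (ε ^ 2)⁻¹ * D ^ 2 ≤ accFactor D ε := le_max_right _ _
    have e : 16 * D ^ 2 / ε ^ 2 = 16 * ((ε ^ 2)⁻¹ * D ^ 2) := by ring
    rw [e] at h ⊢
    linarith
  -- As `log 2 > 1 / 2`, the ceiling is at most `2 + 2 * (l + confFactor δ)`; both `l` and
  -- `confFactor δ` are at least 1, so each summand is absorbed by their product. The logarithm of
  -- `n` is the sole source of the logarithmic factor.
  have h2 : (⌈Real.logb 2 (2 * n / δ)⌉₊ : ℝ) ≤ 6 * (confFactor δ * l) := by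
    have hlog2 := Real.log_two_gt_d9
    have hlogn : Real.log n ≤ l := Real.log_le_log (by linarith) (by linarith)
    have hlogn0 : 0 ≤ Real.log n := Real.log_nonneg hn'
    have hlogδ : Real.log (1 / δ) ≤ confFactor δ := le_max_right _ _
    have e : Real.log (2 * n / δ) = Real.log 2 + Real.log n + Real.log (1 / δ) := by
      rw [mul_div_assoc, Real.log_mul (by norm_num) (by positivity), div_eq_mul_one_div,
        Real.log_mul (by positivity) (by positivity), add_assoc]
    have h3 : Real.logb 2 (2 * n / δ) ≤ 1 + 2 * (l + confFactor δ) := by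
      rw [Real.logb, div_le_iff₀ (by linarith), e]
      nlinarith
    have h4 : (⌈Real.logb 2 (2 * n / δ)⌉₊ : ℝ) ≤ 1 + 2 * (l + confFactor δ) + 1 := by
      refine (Nat.cast_le.2 (Nat.ceil_le_ceil h3)).trans ?_
      exact (Nat.ceil_lt_add_one (by positivity)).le
    nlinarith
  calc ((params n d D ε δ).m : ℝ) = ⌈16 * D ^ 2 / ε ^ 2⌉₊ * ⌈Real.logb 2 (2 * n / δ)⌉₊ := by
        simp [params]
    _ ≤ (17 * accFactor D ε) * (6 * (confFactor δ * l)) := by gcongr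
    _ = _ := by ring

/-- By minimality of the exponent, the range of the random numbers stays linear in `d`. -/
lemma two_pow_clog_le (hd : 1 ≤ d) : 2 ^ Nat.clog 2 (2 * d) ≤ 4 * d := by
  rcases h : Nat.clog 2 (2 * d) with _ | b
  · omega
  · have := (Nat.lt_clog_iff_pow_lt (b := 2) (x := 2 * d) (y := b) (by norm_num)).1 (by omega)
    rw [pow_succ]
    omega

lemma initTime_space_le (hn : 1 ≤ n) (hd : 1 ≤ d) (hD : 0 < D) (hε : 0 < ε) (hδ : 0 < δ)
    (hδ1 : δ < 1) :
    ((initTime n d D ε δ : ℕ) : ℝ) ≤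
        softBound 13000 1 (accFactor D ε * (n * d) * confFactor δ) ∧
      ((space (params n d D ε δ) : ℕ) : ℝ) ≤
        softBound 13000 1 (accFactor D ε * (n * d) * confFactor δ) := by
  have hκ : 1 ≤ accFactor D ε := one_le_accFactor
  have hΛ : 1 ≤ confFactor δ := one_le_confFactor
  have hn' : (1 : ℝ) ≤ n := by exact_mod_cast hn
  have hd' : (1 : ℝ) ≤ d := by exact_mod_cast hd
  have hnd : (n : ℝ) ≤ n * d := le_mul_of_one_le_right (by linarith) hd'
  have hκΛ : 1 ≤ accFactor D ε * confFactor δ := one_le_mul_of_one_le_of_one_le hκ hΛ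
  have hf : (n : ℝ) * d ≤ accFactor D ε * (n * d) * confFactor δ := by
    rw [mul_right_comm]
    exact le_mul_of_one_le_left (by positivity) hκΛ
  have hm := samples_le (d := d) (D := D) (ε := ε) hn hδ (hnd.trans hf)
  have hl := one_le_log (show 1 ≤ accFactor D ε * (n * d) * confFactor δ by linarith)
  unfold softBound
  set l := Real.log (2 + accFactor D ε * (n * d) * confFactor δ)
  set Z := accFactor D ε * confFactor δ * l with hZ
  have hZ1 : 1 ≤ Z := one_le_mul_of_one_le_of_one_le hκΛ hl
  have hnd1 : (1 : ℝ) ≤ n * d := hn'.trans hnd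
  have hZnd : Z ≤ Z * (n * d) := le_mul_of_one_le_right (by linarith) hnd1
  have hndZ : (n : ℝ) * d ≤ Z * (n * d) := le_mul_of_one_le_left (by linarith) hZ1
  have e : 13000 * (accFactor D ε * (n * d) * confFactor δ) * l ^ 1 = 13000 * (Z * (n * d)) := by
    rw [hZ]; ring
  have hKm : ⌈16 * D ^ 2 / ε ^ 2⌉₊ ≤ (params n d D ε δ).m :=
    Nat.le_mul_of_pos_right _ (ceil_logb_pos hn hδ hδ1)
  have hrm : ⌈Real.logb 2 (2 * n / δ)⌉₊ ≤ (params n d D ε δ).m :=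
    Nat.le_mul_of_pos_left _ (ceil_acc_pos hD hε)
  have hb := two_pow_clog_le hd
  have hb' : Nat.clog 2 (2 * d) < 2 ^ Nat.clog 2 (2 * d) := Nat.lt_two_pow_self
  have hn0 : n ≤ n * d := Nat.le_mul_of_pos_right _ hd
  have hd0 : d ≤ n * d := Nat.le_mul_of_pos_left _ hn
  rw [e]
  constructor
  · have h : initTime n d D ε δ ≤ 126 * (n * d) + 14 * (params n d D ε δ).m := by
      unfold initTime; omega
    have h' : ((initTime n d D ε δ : ℕ) : ℝ) ≤ 126 * (n * d) + 14 * (params n d D ε δ).m := by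
      exact_mod_cast h
    linarith
  · have h : space (params n d D ε δ) ≤ 74 * (n * d) + (params n d D ε δ).m := by
      show n * d + n + (params n d D ε δ).m + Nat.clog 2 (2 * d) + 2 ^ Nat.clog 2 (2 * d) + 64 ≤ _
      omega
    have h' : ((space (params n d D ε δ) : ℕ) : ℝ) ≤ 74 * (n * d) + (params n d D ε δ).m := by
      exact_mod_cast h
    linarith

lemma updateTime_le (hd : 1 ≤ d) :
    ((updateTime d : ℕ) : ℝ) ≤ softBound 13000 1 (accFactor D ε * d * confFactor δ) := by
  have hκ : 1 ≤ accFactor D ε := one_le_accFactor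
  have hΛ : 1 ≤ confFactor δ := one_le_confFactor
  have hd' : (1 : ℝ) ≤ d := by exact_mod_cast hd
  have hf : (d : ℝ) ≤ accFactor D ε * d * confFactor δ := by
    rw [mul_right_comm]
    exact le_mul_of_one_le_left (by positivity) (one_le_mul_of_one_le_of_one_le hκ hΛ)
  have hl := one_le_log (hd'.trans hf)
  have h : ((updateTime d : ℕ) : ℝ) = 12 * d + 14 := by simp [updateTime]
  rw [softBound, h, pow_one]
  have := le_mul_of_one_le_right (show 0 ≤ 13000 * (accFactor D ε * d * confFactor δ) by positivity) hl
  linarith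

/-- This bound fixes the constant: a sample costs at most `122 * (n + d)`, there are at most `102 *
Z` samples, and `102 * 122 + 35 = 12479`. -/
lemma queryTime_le (hn : 1 ≤ n) (hd : 1 ≤ d) (hδ : 0 < δ) :
    ((queryTime n d D ε δ : ℕ) : ℝ) ≤
      softBound 13000 1 (accFactor D ε * (n + d) * confFactor δ) := by
  have hκ : 1 ≤ accFactor D ε := one_le_accFactor
  have hΛ : 1 ≤ confFactor δ := one_le_confFactor
  have hn' : (1 : ℝ) ≤ n := by exact_mod_cast hn
  have hd' : (1 : ℝ) ≤ d := by exact_mod_cast hd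
  have hκΛ : 1 ≤ accFactor D ε * confFactor δ := one_le_mul_of_one_le_of_one_le hκ hΛ
  have hf : (n : ℝ) + d ≤ accFactor D ε * (n + d) * confFactor δ := by
    rw [mul_right_comm]
    exact le_mul_of_one_le_left (by positivity) hκΛ
  have hm := samples_le (d := d) (D := D) (ε := ε) hn hδ
    (show (n : ℝ) ≤ accFactor D ε * (n + d) * confFactor δ by linarith)
  have hl := one_le_log (show 1 ≤ accFactor D ε * (n + d) * confFactor δ by linarith)
  unfold softBound
  set l := Real.log (2 + accFactor D ε * (n + d) * confFactor δ)
  set Z := accFactor D ε * confFactor δ * l with hZ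
  have hZ1 : 1 ≤ Z := one_le_mul_of_one_le_of_one_le hκΛ hl
  have hndZ : (n : ℝ) + d ≤ Z * (n + d) := le_mul_of_one_le_left (by linarith) hZ1
  have e : 13000 * (accFactor D ε * (n + d) * confFactor δ) * l ^ 1 = 13000 * (Z * (n + d)) := by
    rw [hZ]; ring
  have hb := two_pow_clog_le hd
  have hb' : Nat.clog 2 (2 * d) < 2 ^ Nat.clog 2 (2 * d) := Nat.lt_two_pow_self
  have h : queryTime n d D ε δ ≤ (params n d D ε δ).m * (122 * (n + d)) + 35 * (n + d) := by
    unfold queryTime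
    have := Nat.mul_le_mul_left (params n d D ε δ).m (show 13 * Nat.clog 2 (2 * d) + 42 * d +
      7 * 2 ^ Nat.clog 2 (2 * d) + 35 * n + 27 ≤ 122 * (n + d) by omega)
    omega
  have h' : ((queryTime n d D ε δ : ℕ) : ℝ) ≤
      (params n d D ε δ).m * (122 * (n + d)) + 35 * (n + d) := by exact_mod_cast h
  have h2 : ((params n d D ε δ).m : ℝ) * (122 * (n + d)) ≤ 102 * Z * (122 * (n + d)) := by
    gcongr
  rw [e]
  nlinarith

end Fixed

end IPE

theorem theorem4p1 :
    ∃ (P : IPE.DataStructure) (C : ℝ) (k : ℕ),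
      ∀ (n d : ℕ) (D ε δ : ℝ), 1 ≤ n → 1 ≤ d → 0 < D → 0 < ε → ε < 1 → 0 < δ → δ < 1 →
        ∃ Ti Tu Tq S : ℕ,
          (S : ℝ) ≤ IPE.softBound C k (IPE.accFactor D ε * (n * d) * IPE.confFactor δ) ∧
          (Ti : ℝ) ≤ IPE.softBound C k (IPE.accFactor D ε * (n * d) * IPE.confFactor δ) ∧
          (Tu : ℝ) ≤ IPE.softBound C k (IPE.accFactor D ε * d * IPE.confFactor δ) ∧
          (Tq : ℝ) ≤ IPE.softBound C k (IPE.accFactor D ε * (n + d) * IPE.confFactor δ) ∧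
          IPE.WorstCase P n d D ε δ Ti Tu Tq S ∧
          ∀ (x : Fin n → IPE.Pt d) (A : IPE.Adversary n d),
            (∀ i, ‖x i‖ ≤ D) → A.Valid D →
            ∀ t : ℕ,
              ENNReal.ofReal (1 - δ) ≤
                (P.play Ti Tu Tq D ε δ x A (t + 1)).toOuterMeasure
                  {s | s.LastCorrect A ε} := by
  refine ⟨IPE.samplingStructure, 13000, 1, fun n d D ε δ hn hd hD hε _ hδ hδ1 =>
    ⟨IPE.initTime n d D ε δ, IPE.updateTime d, IPE.queryTime n d D ε δ,
      IPE.space (IPE.params n d D ε δ), (IPE.initTime_space_le hn hd hD hε hδ hδ1).2,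
      (IPE.initTime_space_le hn hd hD hε hδ hδ1).1, IPE.updateTime_le hd,
      IPE.queryTime_le hn hd hδ, IPE.worstCase hn hd hD hε hδ hδ1,
      fun x A hx hA t => IPE.play_correct hn hd hD hε hδ hδ1 hx hA t⟩⟩
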